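/- Let $k$ be an algebraically closed field and let $A$ be a triangular $k$-algebra with a given presentation $A\simeq kQ_A/I_A$; that is, $Q_A$ is a finite quiver without oriented cycles, $I_A$ is an admissible ideal of the path category $kQ_A$, and $A$ is regarded as a $k$-category whose objects are the vertices of $Q_A$. Suppose that there is a Galois covering $F:\widetilde A\simeq k\widetilde Q/\widetilde I\to A\simeq kQ_A/I_A$, defined by the action of a group $G$, such that $\widetilde A$ is strongly simply connected. Then for every vertex $x$ of $Q_A$ the fundamental group $\pi_1(Q_A,I_A,x)$ is torsion-free: its only element of finite order is $1$. Here the following notions are used. *Presentations.* A presentation $C\simeq kQ/I$ of a $k$-category $C$ consists of a locally finite quiver $Q$ and an admissible ideal $I$ of the path category $kQ$ (every element of $I$ is a combination of paths of length at least two, and for each vertex $x$ all sufficiently long paths starting or ending at $x$ lie in $I$), together with a $k$-linear functor $kQ\to C$ that is bijective on objects, surjective on morphism spaces and has kernel $I$. *Fundamental group.* A minimal relation of $(Q,I)$ is an element $\sum_{i=1}^n\lambda_ip_i\in I(a,b)$ with $n\ge 2$, where the $p_i$ are distinct paths from $a$ to $b$ of length at least two and $\lambda_i \in k$, such that $\sum_{j\in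 J}\lambda_jp_j\notin I(a,b)$ for every non-empty proper subset $J\subset\{1,\dots,n\}$. Homotopy is the smallest equivalence relation $\sim$ on walks, compatible with concatenation, such that $\alpha\alpha^{-1}\sim\varepsilon_a$ and $\alpha^{-1}\alpha\sim\varepsilon_b$ for every arrow $\alpha:a\to b$, and $p_i\sim p_j$ whenever $p_i,p_j$ occur in a common minimal relation. The group $\pi_1(Q,I,x)$ consists of the homotopy classes of closed walks at $x$ under concatenation. *Strong simple connectedness.* A locally bounded $k$-category $\widetilde A\simeq k\widetilde Q/\widetilde I$ with $\widetilde Q$ without oriented cycles is strongly simply connected if there are only finitely many paths between any two vertices of $\widetilde Q$ and if, for every convex full subcategory $C$ of $\widetilde A$ with finitely many objects and every presentation $C\simeq kQ'/I'$, all the groups $\pi_1(Q',I',y)$ are trivial. (Convex: every vertex on a path of $\widetilde Q$ between objects of $C$ is an object of $C$.) *Galois coverings.* A map of quivers $F:\widetilde Q\to Q$ induces a Galois covering $k\widetilde Q/\widetilde I\to kQ/I$ defined by the action of a group $G$ by automorphisms of the bound quiver $(\widetilde Q,\widetilde I)$ if $F$ maps $\widetilde I$ into $I$ and the induced functor is a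 covering functor, i.e. the induced maps $\bigoplus_{Fy'=y}(k\widetilde Q/\widetilde I)(x',y')\to(kQ/I)(Fx',y)$ and $\bigoplus_{Fx'=x}(k\widetilde Q/\widetilde I)(x',y')\to(kQ/I)(x,Fy')$ are bijective for all vertices $x',y'$ of $\widetilde Q$ and $x,y$ of $Q$; $Fg=F$ for all $g\in G$; $F$ is surjective on vertices and arrows and its fibres over vertices and over arrows are orbits of $G$; and $G$ acts freely on the vertices of $\widetilde Q$. -/

import Mathlib

open CategoryTheory Quiver
open scoped DirectSum

universe w u v u' v' u₁ v₁ u₂ v₂ u₃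

noncomputable section

namespace BoundQuiver

/-- The space of morphisms from `a` to `b` of the path category `kQ`: formal `k`-linear
combinations of paths from `a` to `b`. -/
abbrev PathSpace (k : Type w) [Field k] {Q : Type u} [Quiver.{v} Q] (a b : Q) :=
  Path a b →₀ k

/-- A two-sided ideal of the path category `kQ`. By linearity it is enough to require
closedness under composition with paths on both sides. -/
structure PathIdeal (k : Type w) [Field k] (Q : Type u) [Quiver.{v} Q] where
  /-- the subspace `I(a, b)` of `kQ(a, b)` -/
  carrier : ∀ a b : Q, Submodule k (PathSpace k a b)
  comp_left_mem : ∀ {a b c : Q} (p : Path a b) (f : PathSpace k b c), f ∈ carrier b c →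
    Finsupp.mapDomain (fun q : Path b c => p.comp q) f ∈ carrier a c
  comp_right_mem : ∀ {a b c : Q} (f : PathSpace k a b) (p : Path b c), f ∈ carrier a b →
    Finsupp.mapDomain (fun q : Path a b => q.comp p) f ∈ carrier a c

section Quivers

variable (Q : Type u) [Quiver.{v} Q]

/-- A quiver is locally finite if finitely many arrows start, and finitely many end, at each
vertex. -/
structure IsLocallyFinite : Prop where
  finite_star : ∀ a : Q, Finite (Quiver.Star a)
  finite_costar : ∀ a : Q, Finite (Quiver.Costar a)

/-- A quiver is triangular if it has no oriented cycles. -/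
def IsTriangular : Prop := ∀ (a : Q) (p : Path a a), p.length = 0

end Quivers

section Ideals

variable {k : Type w} [Field k] {Q : Type u} [Quiver.{v} Q] (I : PathIdeal k Q)

/-- An ideal of the path category of a locally finite quiver is admissible if it is contained in
the square of the arrow ideal and, for each vertex, contains all sufficiently long paths starting
or ending there. For a finite quiver this is `F ^ N ⊆ I ⊆ F ^ 2`, where `F` is the arrow
ideal. -/
structure PathIdeal.IsAdmissible : Prop where
  two_le_length : ∀ (a b : Q) (f : PathSpace k a b), f ∈ I.carrier a b →
    ∀ p ∈ f.support, 2 ≤ p.length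
  long_from : ∀ a : Q, ∃ N : ℕ, ∀ (b : Q) (p : Path a b), N ≤ p.length →
    Finsupp.single p (1 : k) ∈ I.carrier a b
  long_to : ∀ b : Q, ∃ N : ℕ, ∀ (a : Q) (p : Path a b), N ≤ p.length →
    Finsupp.single p (1 : k) ∈ I.carrier a b

/-- The space `(kQ/I)(a, b)` of morphisms from `a` to `b` of the quotient category `kQ/I`. -/
def PathIdeal.QuotHom (a b : Q) : Type (max u v w) := PathSpace k a b ⧸ I.carrier a b

instance (a b : Q) : AddCommGroup (I.QuotHom a b) :=
  inferInstanceAs (AddCommGroup (PathSpace k a b ⧸ I.carrier a b))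

instance (a b : Q) : Module k (I.QuotHom a b) :=
  inferInstanceAs (Module k (PathSpace k a b ⧸ I.carrier a b))

/-- `ρ = ∑ λ_p p` in `I(a, b)` is a minimal relation if it involves at least two paths, all of
length at least two, and no nonempty proper subsum lies in `I(a, b)`. -/
structure PathIdeal.IsMinimalRelation {a b : Q} (ρ : PathSpace k a b) : Prop where
  mem : ρ ∈ I.carrier a b
  two_le_length : ∀ p ∈ ρ.support, 2 ≤ p.length
  two_le_card : 2 ≤ ρ.support.card
  subsum_notMem : ∀ J : Finset (Path a b), J.Nonempty → J ⊂ ρ.support →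
    ∑ p ∈ J, Finsupp.single p (ρ p) ∉ I.carrier a b

/-- A walk in `Q`: a composable sequence of arrows and formal inverses of arrows. -/
abbrev Walk (a b : Symmetrify Q) := Path a b

/-- A path regarded as a walk. -/
def Walk.ofPath {a b : Q} (p : Path a b) : Walk (Symmetrify.of.obj a) (Symmetrify.of.obj b) :=
  Symmetrify.of.mapPath p

/-- The homotopy relation on walks: the smallest equivalence relation, compatible with
concatenation, that cancels an arrow or formal inverse of an arrow against its formal inverse and
identifies any two paths occurring in a common minimal relation. -/
inductive Homotopic : ∀ {a b : Symmetrify Q}, Walk a b → Walk a b → Prop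
  | refl {a b : Symmetrify Q} (u : Walk a b) : Homotopic u u
  | symm {a b : Symmetrify Q} {u v : Walk a b} : Homotopic u v → Homotopic v u
  | trans {a b : Symmetrify Q} {u v w : Walk a b} :
      Homotopic u v → Homotopic v w → Homotopic u w
  | cancel {a b : Symmetrify Q} (e : a ⟶ b) :
      Homotopic (e.toPath.comp (Quiver.reverse e).toPath) Path.nil
  | relation {a b : Q} (ρ : PathSpace k a b) (hρ : I.IsMinimalRelation ρ) (p q : Path a b)
      (hp : p ∈ ρ.support) (hq : q ∈ ρ.support) : Homotopic (Walk.ofPath p) (Walk.ofPath q)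
  | congr {a b c d : Symmetrify Q} (w₁ : Walk a b) {u v : Walk b c} (w₂ : Walk c d) :
      Homotopic u v → Homotopic ((w₁.comp u).comp w₂) ((w₁.comp v).comp w₂)

/-- Homotopy of closed walks at `x`. -/
def homotopySetoid (x : Q) : Setoid (Walk (Symmetrify.of.obj x) (Symmetrify.of.obj x)) where
  r := Homotopic I
  iseqv := ⟨.refl, .symm, .trans⟩

/-- The fundamental group `π₁(Q, I, x)`: homotopy classes of closed walks at `x`, with the
product induced by concatenation. -/
def FundamentalGroup (x : Q) : Type (max u v) := Quotient (homotopySetoid I x)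

variable {I}

theorem Homotopic.comp {a b c : Symmetrify Q} {u u' : Walk a b} {v v' : Walk b c}
    (hu : Homotopic I u u') (hv : Homotopic I v v') :
    Homotopic I (u.comp v) (u'.comp v') := by
  have h₁ := Homotopic.congr Path.nil v hu
  have h₂ := Homotopic.congr u' Path.nil hv
  rw [Path.nil_comp, Path.nil_comp] at h₁
  rw [Path.comp_nil, Path.comp_nil] at h₂
  exact h₁.trans h₂

theorem Homotopic.self_comp_reverse {a b : Symmetrify Q} (u : Walk a b) :
    Homotopic I (u.comp u.reverse) Path.nil := by
  induction u with
  | nil => exact .refl _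
  | cons u e ih =>
    have h := Homotopic.congr u u.reverse (Homotopic.cancel (I := I) e)
    rw [Path.comp_nil] at h
    have h' := h.trans ih
    rw [← Path.comp_assoc, Path.comp_assoc, Path.comp_toPath_eq_cons] at h'
    exact h'

theorem Homotopic.reverse_comp_self {a b : Symmetrify Q} (u : Walk a b) :
    Homotopic I (u.reverse.comp u) Path.nil := by
  have h := Homotopic.self_comp_reverse (I := I) u.reverse
  rwa [Path.reverse_reverse] at h

theorem Homotopic.reverse {a b : Symmetrify Q} {u v : Walk a b} (h : Homotopic I u v) :
    Homotopic I u.reverse v.reverse := by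
  have h₁ := Homotopic.comp (.refl u.reverse) (Homotopic.self_comp_reverse (I := I) v)
  have h₂ := Homotopic.congr u.reverse v.reverse h
  have h₃ := Homotopic.comp (Homotopic.reverse_comp_self (I := I) u) (.refl v.reverse)
  rw [Path.comp_nil, ← Path.comp_assoc] at h₁
  rw [Path.nil_comp] at h₃
  exact h₁.symm.trans (h₂.symm.trans h₃)

instance (x : Q) : Group (FundamentalGroup I x) where
  mul := Quotient.map₂ (fun u v => u.comp v) fun _ _ hu _ _ hv => Homotopic.comp hu hv
  one := Quotient.mk (homotopySetoid I x) Path.nil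
  inv := Quotient.map (fun u => u.reverse) fun _ _ hu => Homotopic.reverse hu
  mul_assoc := by
    rintro ⟨u⟩ ⟨v⟩ ⟨w⟩
    exact congrArg (Quotient.mk (homotopySetoid I x)) (Path.comp_assoc u v w)
  one_mul := by
    rintro ⟨u⟩
    exact congrArg (Quotient.mk (homotopySetoid I x)) (Path.nil_comp u)
  mul_one := by
    rintro ⟨u⟩
    exact congrArg (Quotient.mk (homotopySetoid I x)) (Path.comp_nil u)
  inv_mul_cancel := by
    rintro ⟨u⟩
    exact Quotient.sound (s := homotopySetoid I x) (Homotopic.reverse_comp_self u)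

end Ideals

section Presentations

variable {k : Type w} [Field k] {Q : Type u} [Quiver.{v} Q]
  {A : Type u₁} [Category.{v₁} A] [Preadditive A] [Linear k A]

/-- The image in `A` of a path of `Q`, for a choice `φ` of the images of vertices and arrows. -/
def pathValue (φ : Q ⥤q A) {a b : Q} (p : Path a b) : φ.obj a ⟶ φ.obj b :=
  composePath (φ.mapPath p)

/-- The action on morphisms of the `k`-linear functor `kQ ⥤ A` determined by the images `φ` of
vertices and arrows. -/
def eval (k : Type w) [Field k] [Linear k A] (φ : Q ⥤q A) (a b : Q) :
    PathSpace k a b →ₗ[k] (φ.obj a ⟶ φ.obj b) :=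
  Finsupp.linearCombination k (pathValue φ)

theorem pathValue_comp (φ : Q ⥤q A) {a b c : Q} (p : Path a b) (q : Path b c) :
    pathValue φ (p.comp q) = pathValue φ p ≫ pathValue φ q := by
  simp [pathValue, Prefunctor.mapPath_comp, composePath_comp]

theorem eval_comp_left (φ : Q ⥤q A) {a b c : Q} (p : Path a b) (f : PathSpace k b c) :
    eval k φ a c (Finsupp.mapDomain (fun q : Path b c => p.comp q) f) =
      pathValue φ p ≫ eval k φ b c f := by
  induction f using Finsupp.induction_linear with
  | zero => simp
  | add f g hf hg => simp [Finsupp.mapDomain_add, hf, hg]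
  | single q r => simp [eval, Finsupp.mapDomain_single, pathValue_comp]

theorem eval_comp_right (φ : Q ⥤q A) {a b c : Q} (f : PathSpace k a b) (p : Path b c) :
    eval k φ a c (Finsupp.mapDomain (fun q : Path a b => q.comp p) f) =
      eval k φ a b f ≫ pathValue φ p := by
  induction f using Finsupp.induction_linear with
  | zero => simp
  | add f g hf hg => simp [Finsupp.mapDomain_add, hf, hg]
  | single q r => simp [eval, Finsupp.mapDomain_single, pathValue_comp]

/-- The kernel of the `k`-linear functor `kQ ⥤ A` determined by `φ`. -/
def kernelIdeal (k : Type w) [Field k] [Linear k A] (φ : Q ⥤q A) : PathIdeal k Q where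
  carrier a b := LinearMap.ker (eval k φ a b)
  comp_left_mem p f hf := by
    rw [LinearMap.mem_ker] at hf ⊢
    rw [eval_comp_left, hf, Limits.comp_zero]
  comp_right_mem f p hf := by
    rw [LinearMap.mem_ker] at hf ⊢
    rw [eval_comp_right, hf, Limits.zero_comp]

variable (k Q A)

/-- A presentation `A ≃ kQ/I` of a `k`-category `A` by a locally finite quiver `Q` and an
admissible ideal `I`, given as a `k`-linear functor `kQ ⥤ A` (that is, by the images of vertices
and arrows) that is bijective on objects, surjective on morphism spaces and has the admissible
kernel `I`. The `k`-categories having a presentation are the locally bounded ones. -/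
structure Presentation where
  /-- the images in `A` of the vertices and arrows of `Q` -/
  toPrefunctor : Q ⥤q A
  isLocallyFinite : IsLocallyFinite Q
  bijective_obj : Function.Bijective toPrefunctor.obj
  surjective_eval : ∀ a b : Q, Function.Surjective (eval k toPrefunctor a b)
  isAdmissible : (kernelIdeal k toPrefunctor).IsAdmissible

variable {k Q A}

/-- The ideal `I` of a presentation `A ≃ kQ/I`. -/
def Presentation.ideal (ν : Presentation k Q A) : PathIdeal k Q :=
  kernelIdeal k ν.toPrefunctor

/-- The full subcategory of `A` on the objects satisfying `P` is convex if, for every path of the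
quiver of `A` whose end points satisfy `P`, all vertices on the path satisfy `P`. -/
def Presentation.IsConvex (ν : Presentation k Q A) (P : ObjectProperty A) : Prop :=
  ∀ ⦃a b c : Q⦄, Path a b → Path b c → P (ν.toPrefunctor.obj a) → P (ν.toPrefunctor.obj c) →
    P (ν.toPrefunctor.obj b)

/-- A `k`-category with finitely many objects is simply connected if for every presentation
`C ≃ kV/J` the fundamental group of `(V, J)` is trivial (at every vertex, so that no connectedness
of `C` is required). Since such a `V` has finitely many vertices and arrows, the choice of the
universes `u` and `v` in which `V` lives does not matter. -/
def IsSimplyConnected (k : Type w) [Field k] (C : Type u₁) [Category.{v₁} C] [Preadditive C]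
    [Linear k C] : Prop :=
  ∀ (V : Type u) [Quiver.{v} V] (μ : Presentation k V C) (x : V),
    Subsingleton (FundamentalGroup μ.ideal x)

/-- A triangular locally bounded `k`-category `A ≃ kQ/I` is strongly simply connected if there are
only finitely many paths of `Q` between any two vertices and every convex full subcategory of `A`
with finitely many objects is simply connected. -/
structure Presentation.IsStronglySimplyConnected (ν : Presentation k Q A) : Prop where
  isTriangular : IsTriangular Q
  finite_path : ∀ x y : Q, Finite (Path x y)
  isSimplyConnected : ∀ P : ObjectProperty A, Finite P.FullSubcategory → ν.IsConvex P →
    IsSimplyConnected.{w, u, v} k P.FullSubcategory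

end Presentations

section Coverings

variable {k : Type w} [Field k] {Q' : Type u₁} [Quiver.{v₁} Q'] {Q : Type u} [Quiver.{v} Q]

/-- The `k`-linear map `kQ'(x', y') → kQ(x, y)` induced by a quiver map `F` with `F x' = x` and
`F y' = y`. -/
def push (k : Type w) [Field k] (F : Q' ⥤q Q) {x' y' : Q'} {x y : Q} (hx : F.obj x' = x)
    (hy : F.obj y' = y) : PathSpace k x' y' →ₗ[k] PathSpace k x y :=
  Finsupp.lmapDomain k k fun p : Path x' y' => (F.mapPath p).cast hx hy

/-- `F` is a map of bound quivers `(Q', I') → (Q, I)`: it maps `I'` into `I`. -/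
def MapsIdeal (F : Q' ⥤q Q) (I' : PathIdeal k Q') (I : PathIdeal k Q) : Prop :=
  ∀ (x' y' : Q') (f : PathSpace k x' y'), f ∈ I'.carrier x' y' →
    push k F rfl rfl f ∈ I.carrier (F.obj x') (F.obj y')

variable {F : Q' ⥤q Q} {I' : PathIdeal k Q'} {I : PathIdeal k Q}

theorem MapsIdeal.le_comap (h : MapsIdeal F I' I) {x' y' : Q'} {x y : Q} (hx : F.obj x' = x)
    (hy : F.obj y' = y) : I'.carrier x' y' ≤ (I.carrier x y).comap (push k F hx hy) := by
  subst hx hy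
  exact h x' y'

/-- The map `(kQ'/I')(x', y') → (kQ/I)(x, y)` induced by a map of bound quivers. -/
def MapsIdeal.mapHom (h : MapsIdeal F I' I) {x' y' : Q'} {x y : Q} (hx : F.obj x' = x)
    (hy : F.obj y' = y) : I'.QuotHom x' y' →ₗ[k] I.QuotHom x y :=
  (I'.carrier x' y').mapQ (I.carrier x y) (push k F hx hy) (h.le_comap hx hy)

open Classical in
/-- The map `⨁_{F y' = y} (kQ'/I')(x', y') → (kQ/I)(F x', y)`. -/
def MapsIdeal.coverOut (h : MapsIdeal F I' I) (x' : Q') (y : Q) :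
    (⨁ y' : {y' : Q' // F.obj y' = y}, I'.QuotHom x' y'.1) →ₗ[k]
      I.QuotHom (F.obj x') y :=
  DirectSum.toModule k _ _ fun y' => h.mapHom rfl y'.2

open Classical in
/-- The map `⨁_{F x' = x} (kQ'/I')(x', y') → (kQ/I)(x, F y')`. -/
def MapsIdeal.coverIn (h : MapsIdeal F I' I) (x : Q) (y' : Q') :
    (⨁ x' : {x' : Q' // F.obj x' = x}, I'.QuotHom x'.1 y') →ₗ[k]
      I.QuotHom x (F.obj y') :=
  DirectSum.toModule k _ _ fun x' => h.mapHom x'.2 rfl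

/-- An action of a group on a quiver by automorphisms. -/
structure QuiverAction (G : Type u₂) [Group G] (Q' : Type u₁) [Quiver.{v₁} Q'] where
  /-- the automorphism by which `g` acts -/
  act : G → Q' ⥤q Q'
  act_one : act 1 = 𝟭q Q'
  act_mul : ∀ g h : G, act (g * h) = act h ⋙q act g

/-- The map induced by a quiver map on the sets of all arrows. -/
def arrowMap (F : Q' ⥤q Q) (α : Quiver.Total Q') : Quiver.Total Q :=
  ⟨F.obj α.left, F.obj α.right, F.map α.hom⟩

/-- The quiver map `F : Q' → Q` induces a Galois covering `kQ'/I' → kQ/I` defined by the action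
`ρ` of the group `G` by automorphisms of the bound quiver `(Q', I')`:
* `F` maps `I'` into `I`, and the induced functor is a covering functor, i.e. it induces
  isomorphisms `⨁_{F y' = y} (kQ'/I')(x', y') ≃ (kQ/I)(F x', y)` and
  `⨁_{F x' = x} (kQ'/I')(x', y') ≃ (kQ/I)(x, F y')`;
* `F g = F` for all `g` in `G`;
* `F` is surjective, and its fibres over vertices and over arrows are orbits of `G`;
* `G` acts freely on vertices. -/
structure IsGaloisCovering {G : Type u₂} [Group G] (ρ : QuiverAction G Q') (F : Q' ⥤q Q)
    (I' : PathIdeal k Q') (I : PathIdeal k Q) : Prop where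
  act_mapsIdeal : ∀ g : G, MapsIdeal (ρ.act g) I' I'
  mapsIdeal : MapsIdeal F I' I
  bijective_coverOut : ∀ (x' : Q') (y : Q), Function.Bijective (mapsIdeal.coverOut x' y)
  bijective_coverIn : ∀ (x : Q) (y' : Q'), Function.Bijective (mapsIdeal.coverIn x y')
  act_comp : ∀ g : G, ρ.act g ⋙q F = F
  surjective_obj : Function.Surjective F.obj
  surjective_arrow : Function.Surjective (arrowMap F)
  orbit_obj : ∀ x y : Q', F.obj x = F.obj y → ∃ g : G, (ρ.act g).obj x = y
  orbit_arrow : ∀ α β : Quiver.Total Q', arrowMap F α = arrowMap F β →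
    ∃ g : G, arrowMap (ρ.act g) α = β
  free : ∀ (g : G) (x : Q'), (ρ.act g).obj x = x → g = 1

end Coverings

end BoundQuiver

end

/-! It suffices to rule out elements of prime order `p`. Let the closed walk `u` represent a class
with trivial `p`-th power, and lift it to the covering, from `x'` to `g x'` say. Homotopic walks
have lifts with the same end points, because injectivity of `coverOut` forces all paths of a minimal
relation to lift together (`liftsTo_of_isMinimalRelation`). Hence `g ^ p` fixes `x'`, and `g ^ p =
1` by freeness. If `g = 1`, the lift is a closed walk; it is null-homotopic upstairs, and the
homotopy projects down to one for `u`.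

If `g ≠ 1`, then `g` acts without fixed vertices and with order `p`. The translates of the support
of the lifted walk form a finite connected stable set, and so does their convex hull. The core of
the proof (`Presentation.IsStronglySimplyConnected.not_isConnectedSet`) is that no such nonempty set
`C` exists. Take the sources of `C`, contract each connected component of the remaining vertices to
a point, and join a source to a component when some arrow leads from one to the other. Simple
connectedness of `C` makes this bipartite graph a tree: every rational function on its edges is a
coboundary, so it has exactly one more vertex than edges (`natCard_contraction`). No edge is fixed,
since its source is moved. If no vertex were fixed either, `p` would divide both numbers. So some
component is stable; it is again convex and connected, and smaller than `C` because `C` has a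
source. Descent on the cardinality gives the contradiction. -/

theorem prime_dvd_natCard_of_iterate_eq_id {α : Type*} [Finite α] {p : ℕ} (hp : p.Prime)
    (f : α → α) (hf : ∀ x, f^[p] x = x) (hfix : ∀ x, f x ≠ x) : p ∣ Nat.card α := by
  classical
  have := Fintype.ofFinite α
  have : Fact p.Prime := ⟨hp⟩
  have h : (show Function.End α from f) ^ p ^ 1 = 1 := by
    funext x
    rw [pow_one]
    have hiter : ∀ n : ℕ, ((show Function.End α from f) ^ n) x = f^[n] x := fun n => by
      induction n with
      | zero => rfl
      | succ n ih =>
        rw [pow_succ', Function.iterate_succ_apply', ← ih]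
        rfl
    rw [hiter, hf]
    rfl
  have hmod := Equiv.Perm.card_fixedPoints_modEq h
  have hempty : IsEmpty (Function.fixedPoints f) := ⟨fun x => hfix x.1 x.2⟩
  have hzero : Fintype.card (Function.fixedPoints f) = 0 := Fintype.card_eq_zero
  rw [Nat.card_eq_fintype_card]
  refine (Nat.modEq_zero_iff_dvd).1 (hmod.trans ?_)
  exact Nat.modEq_of_dvd (by simp only [hzero]; simp)

namespace BoundQuiver

/-! ### Transport of homotopies along quiver maps -/

section Push

variable {k : Type w} [Field k] {V : Type u₁} [Quiver.{v₁} V] {Q : Type u} [Quiver.{v} Q]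
  {J : PathIdeal k V} {I : PathIdeal k Q}

theorem length_mapPath (φ : V ⥤q Q) {a b : V} (p : Path a b) :
    (φ.mapPath p).length = p.length := by
  induction p with
  | nil => rfl
  | cons p e ih => simp [ih]

theorem symmetrify_mapPath_ofPath (φ : V ⥤q Q) {a b : V} (p : Path a b) :
    φ.symmetrify.mapPath (Walk.ofPath p) = Walk.ofPath (φ.mapPath p) := by
  induction p with
  | nil => rfl
  | cons p e ih =>
    change (φ.symmetrify.mapPath (Walk.ofPath p)).cons _ = (Walk.ofPath (φ.mapPath p)).cons _
    rw [ih]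
    rfl

/-- A quiver map reflects and preserves ideals if it is injective on parallel paths and a
combination of parallel paths lies in the ideal exactly when its image does. -/
structure ReflectsIdeal (φ : V ⥤q Q) (J : PathIdeal k V) (I : PathIdeal k Q) : Prop where
  injective : ∀ a b : V, Function.Injective (φ.mapPath : Path a b → _)
  mem_iff : ∀ (a b : V) (f : PathSpace k a b),
    f ∈ J.carrier a b ↔ Finsupp.mapDomain φ.mapPath f ∈ I.carrier (φ.obj a) (φ.obj b)

/-- Injectivity on parallel paths identifies the two supports, so a proper subsum of the image comes
from a proper subsum of `ρ`; since membership is reflected, minimality survives. It is used for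
inclusions of convex subquivers and for the covering map. -/
theorem PathIdeal.IsMinimalRelation.map {φ : V ⥤q Q} (hφ : ReflectsIdeal φ J I) {a b : V}
    {ρ : PathSpace k a b} (hρ : J.IsMinimalRelation ρ) :
    I.IsMinimalRelation (Finsupp.mapDomain φ.mapPath ρ) := by
  classical
  have hinj := hφ.injective a b
  have hsupp := Finsupp.mapDomain_support_of_injective hinj ρ
  refine ⟨(hφ.mem_iff a b ρ).1 hρ.mem, ?_, ?_, ?_⟩
  · intro p hp
    rw [hsupp, Finset.mem_image] at hp
    obtain ⟨q, hq, rfl⟩ := hp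
    rw [length_mapPath]
    exact hρ.two_le_length q hq
  · rw [hsupp, Finset.card_image_of_injective _ hinj]
    exact hρ.two_le_card
  · intro K hK hKs hmem
    rw [hsupp] at hKs
    obtain ⟨K₀, hK₀, rfl⟩ := Finset.subset_image_iff.1 hKs.1
    refine hρ.subsum_notMem K₀ (Finset.image_nonempty.1 hK) ⟨hK₀, fun h => hKs.2 ?_⟩ ?_
    · exact Finset.image_subset_image h
    · rw [hφ.mem_iff, Finsupp.mapDomain_finsetSum]
      rw [Finset.sum_image fun _ _ _ _ h => hinj h] at hmem
      simpa only [Finsupp.mapDomain_single, Finsupp.mapDomain_apply hinj] using hmem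

theorem Homotopic.map {φ : V ⥤q Q} (hφ : ReflectsIdeal φ J I) {a b : Symmetrify V}
    {u v : Walk a b} (h : Homotopic J u v) :
    Homotopic I (φ.symmetrify.mapPath u) (φ.symmetrify.mapPath v) := by
  classical
  induction h with
  | refl u => exact .refl _
  | symm _ ih => exact ih.symm
  | trans _ _ ih₁ ih₂ => exact ih₁.trans ih₂
  | cancel e =>
    have h := Homotopic.cancel (I := I) (φ.symmetrify.map e)
    rw [← φ.symmetrify.map_reverse] at h
    exact h
  | relation ρ hρ p q hp hq =>
    rw [symmetrify_mapPath_ofPath, symmetrify_mapPath_ofPath]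
    have hsupp := Finsupp.mapDomain_support_of_injective (hφ.injective _ _) ρ
    refine Homotopic.relation _ (hρ.map hφ) _ _ ?_ ?_ <;> rw [hsupp]
    · exact Finset.mem_image_of_mem _ hp
    · exact Finset.mem_image_of_mem _ hq
  | congr w₁ w₂ _ ih =>
    rw [Prefunctor.mapPath_comp, Prefunctor.mapPath_comp, Prefunctor.mapPath_comp,
      Prefunctor.mapPath_comp]
    exact .congr _ _ ih

end Push

/-! ### Homotopy-invariant weights and potentials -/

section Potentials

variable {k : Type w} [Field k] {V : Type u} [Quiver.{v} V] {I : PathIdeal k V}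

/-- The extension of a weight function on arrows to formal inverses. -/
def symmWeight {K : Type*} [AddCommGroup K] (f : ∀ {a b : V}, (a ⟶ b) → K) {a b : Symmetrify V}
    (e : a ⟶ b) : K :=
  Sum.elim (fun e' : @Quiver.Hom V _ a b => f e') (fun e' : @Quiver.Hom V _ b a => -f e') e

theorem addWeight_ofPath {K : Type*} [AddCommGroup K] (f : ∀ {a b : V}, (a ⟶ b) → K) {a b : V}
    (p : Path a b) : (Walk.ofPath p).addWeight (symmWeight f) = p.addWeight f := by
  induction p with
  | nil => exact (Path.addWeight_nil _ _).trans (Path.addWeight_nil _ _).symm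
  | cons p e ih =>
    refine (Path.addWeight_cons _ (Walk.ofPath p) _).trans ?_
    rw [ih, Path.addWeight_cons]
    rfl

theorem Homotopic.addWeight_eq {K : Type*} [AddCommGroup K] (f : ∀ {a b : V}, (a ⟶ b) → K)
    (hf : ∀ (a b : V) (ρ : PathSpace k a b), I.IsMinimalRelation ρ → ∀ p ∈ ρ.support,
      ∀ q ∈ ρ.support, p.addWeight f = q.addWeight f)
    {a b : Symmetrify V} {u v : Walk a b} (h : Homotopic I u v) :
    u.addWeight (symmWeight f) = v.addWeight (symmWeight f) := by
  induction h with
  | refl u => rfl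
  | symm _ ih => exact ih.symm
  | trans _ _ ih₁ ih₂ => exact ih₁.trans ih₂
  | cancel e =>
    rw [← Path.comp_nil (e.toPath.comp _), Path.comp_toPath_eq_cons, Path.comp_nil,
      Path.addWeight_cons, Hom.toPath, Path.addWeight_cons, Path.addWeight_nil]
    rcases e with e | e <;> simp [symmWeight]
  | relation ρ hρ p q hp hq =>
    rw [addWeight_ofPath, addWeight_ofPath]
    exact hf _ _ ρ hρ p hp q hq
  | congr w₁ w₂ _ ih => simp only [Path.addWeight_comp, ih]

/-- The vertices `a` and `b` are joined by an arrow from `a` to `b`. -/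
def Adj (a b : V) : Prop := Nonempty (a ⟶ b)

theorem nonempty_walk_of_eqvGen {a b : V} (h : Relation.EqvGen Adj a b) :
    Nonempty (Walk (Symmetrify.of.obj a) (Symmetrify.of.obj b)) := by
  induction h with
  | rel a b h => exact ⟨Walk.ofPath h.some.toPath⟩
  | refl a => exact ⟨Path.nil⟩
  | symm a b _ ih => exact ⟨ih.some.reverse⟩
  | trans a b c _ _ ih₁ ih₂ => exact ⟨ih₁.some.comp ih₂.some⟩

/-- This is the vanishing of first cohomology: closed walks have weight zero, so the weight of a
walk from a base point depends only on where it ends and serves as the potential. -/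
theorem exists_potential {K : Type*} [AddCommGroup K]
    (hπ : ∀ x : V, Subsingleton (FundamentalGroup I x))
    (hconn : ∀ a b : V, Relation.EqvGen Adj a b) (f : ∀ {a b : V}, (a ⟶ b) → K)
    (hf : ∀ (a b : V) (ρ : PathSpace k a b), I.IsMinimalRelation ρ → ∀ p ∈ ρ.support,
      ∀ q ∈ ρ.support, p.addWeight f = q.addWeight f) :
    ∃ c : V → K, ∀ (a b : V) (e : a ⟶ b), f e = c b - c a := by
  rcases isEmpty_or_nonempty V with _ | ⟨⟨x⟩⟩
  · exact ⟨fun _ => 0, fun a => isEmptyElim a⟩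
  have hclosed : ∀ u : Walk (Symmetrify.of.obj x) (Symmetrify.of.obj x),
      u.addWeight (symmWeight f) = 0 := fun u =>
    (Quotient.exact (s := homotopySetoid I x)
      ((hπ x).elim (Quotient.mk _ u) (Quotient.mk _ Path.nil))).addWeight_eq f hf |>.trans
      (Path.addWeight_nil _ _)
  let t := fun a => (nonempty_walk_of_eqvGen (hconn x a)).some
  refine ⟨fun a => (t a).addWeight (symmWeight f), fun a b e => ?_⟩
  -- Comparing these two closed walks cancels the common return from `b`, so no formula for the
  -- weight of a reversed walk is needed.
  have h₁ := hclosed ((t b).comp (t b).reverse)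
  have h₂ := hclosed (((t a).comp (Walk.ofPath e.toPath)).comp (t b).reverse)
  rw [Path.addWeight_comp] at h₁ h₂
  rw [Path.addWeight_comp, addWeight_ofPath] at h₂
  have h₃ : e.toPath.addWeight f = f e := by
    rw [Hom.toPath, Path.addWeight_cons, Path.addWeight_nil, zero_add]
  rw [h₃] at h₂
  have h₄ := add_right_cancel (h₂.trans h₁.symm)
  exact eq_sub_of_add_eq' h₄

end Potentials

/-! ### The tree of sources and components -/

section Sources

variable {k : Type w} [Field k] {V : Type u} [Quiver.{v} V]

/-- The set obtained from the vertices of a quiver by contracting the connected components of the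
complement of `S`, for a set `S` of sources. -/
def Contraction (S : Set V) : Type u := Quot fun a b : V => a ∉ S ∧ Adj a b

/-- The image of a vertex in the contraction. -/
def Contraction.mk (S : Set V) (a : V) : Contraction S := Quot.mk _ a

theorem Contraction.sound {S : Set V} {a b : V} (ha : a ∉ S) (hab : Adj a b) :
    Contraction.mk S a = Contraction.mk S b := Quot.sound ⟨ha, hab⟩

theorem Contraction.ind {S : Set V} {P : Contraction S → Prop}
    (h : ∀ a, P (Contraction.mk S a)) (D : Contraction S) : P D := Quot.ind h D

/-- The edges of the bipartite graph between the sources in `S` and the connected components of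
the complement of `S`. -/
def ContractionEdge (S : Set V) : Type u :=
  {e : V × Contraction S // e.1 ∈ S ∧ ∃ b, Adj e.1 b ∧ Contraction.mk S b = e.2}

instance (S : Set V) [Finite V] : Finite (Contraction S) := Quot.finite _

instance (S : Set V) [Finite V] : Finite (ContractionEdge S) := Subtype.finite

/-- The difference of a function along the edges from sources to components. -/
def contractionDiff (S : Set V) : (Contraction S → ℚ) →ₗ[ℚ] (ContractionEdge S → ℚ) where
  toFun φ e := φ e.1.2 - φ (Contraction.mk S e.1.1)
  map_add' _ _ := funext fun _ => add_sub_add_comm _ _ _ _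
  map_smul' _ _ := funext fun _ => (mul_sub _ _ _).symm

/-- A function on edges becomes a weight on arrows, charged only to arrows leaving `S`. All vertices
of a path after the first lie in one component, so its weight depends only on its end points. The
weight is therefore homotopy invariant and has a potential. -/
theorem contractionDiff_surjective {I : PathIdeal k V}
    (hπ : ∀ x : V, Subsingleton (FundamentalGroup I x))
    (hconn : ∀ a b : V, Relation.EqvGen Adj a b) {S : Set V}
    (hS : ∀ a b : V, Adj a b → b ∉ S) : Function.Surjective (contractionDiff S) := by
  classical
  intro h
  -- The value zero off the edges is a dummy: an arrow leaving `S` always gives an edge.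
  let h' : V → Contraction S → ℚ := fun a D => if he : _ then h ⟨(a, D), he⟩ else 0
  let f : ∀ {a b : V}, (a ⟶ b) → ℚ := fun {a b} _ => if a ∈ S then h' a (Contraction.mk S b) else 0
  have hpath : ∀ (a b : V) (p : Path a b), 1 ≤ p.length →
      p.addWeight f = if a ∈ S then h' a (Contraction.mk S b) else 0 := by
    intro a b p
    induction p with
    | nil => intro h; simp at h
    | @cons c b p e ih =>
      intro _
      rcases Nat.eq_zero_or_pos p.length with h0 | h0
      · obtain rfl := p.eq_of_length_zero h0
        rw [p.eq_nil_of_length_zero h0]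
        rw [Path.addWeight_cons, Path.addWeight_nil, zero_add]
      · have hc : c ∉ S := by
          cases p with
          | nil => simp at h0
          | cons p e' => exact hS _ _ ⟨e'⟩
        have hcb : Contraction.mk S c = Contraction.mk S b := Contraction.sound hc ⟨e⟩
        rw [Path.addWeight_cons, ih h0, hcb]
        simp [f, hc]
  obtain ⟨c, hc⟩ := exists_potential hπ hconn f fun a b ρ hρ p hp q hq => by
    rw [hpath a b p (by have := hρ.two_le_length p hp; omega),
      hpath a b q (by have := hρ.two_le_length q hq; omega)]
  -- The potential descends to the contraction because arrows starting outside `S` have weight zero.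
  refine ⟨Quot.lift c ?_, ?_⟩
  · rintro a b ⟨ha, ⟨e⟩⟩
    have := hc a b e
    simp only [f, if_neg ha] at this
    linarith
  · funext e
    obtain ⟨⟨a, D⟩, ha, b, ⟨e⟩, hD⟩ := e
    obtain rfl : _ = D := hD
    change c b - c a = _
    rw [← hc a b e]
    have he : a ∈ S ∧ ∃ b', Adj a b' ∧
        Contraction.mk S b' = Contraction.mk S b := ⟨ha, b, ⟨e⟩, rfl⟩
    simp only [f, h', if_pos (show a ∈ S from ha)]
    exact dif_pos he

theorem mem_ker_contractionDiff_iff [Nonempty V]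
    (hconn : ∀ a b : V, Relation.EqvGen Adj a b) {S : Set V} (φ : Contraction S → ℚ) :
    φ ∈ LinearMap.ker (contractionDiff S) ↔ φ ∈ Submodule.span ℚ {fun _ => (1 : ℚ)} := by
  rw [LinearMap.mem_ker, Submodule.mem_span_singleton]
  constructor
  · intro h
    have hstep : ∀ a b : V, Adj a b → φ (Contraction.mk S a) = φ (Contraction.mk S b) := by
      intro a b hab
      by_cases ha : a ∈ S
      · have := congrFun h ⟨(a, Contraction.mk S b), ha, b, hab, rfl⟩
        exact (sub_eq_zero.1 this).symm
      · exact congrArg φ (Contraction.sound ha hab)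
    have hconst : ∀ a b : V, Relation.EqvGen Adj a b →
        φ (Contraction.mk S a) = φ (Contraction.mk S b) := by
      intro a b hab
      induction hab with
      | rel a b h => exact hstep a b h
      | refl a => rfl
      | symm a b _ ih => exact ih.symm
      | trans a b c _ _ ih₁ ih₂ => exact ih₁.trans ih₂
    obtain ⟨x⟩ := ‹Nonempty V›
    refine ⟨φ (Contraction.mk S x), ?_⟩
    funext D
    induction D using Contraction.ind with
    | h a => exact (mul_one _).trans (hconst x a (hconn x a))
  · rintro ⟨c, rfl⟩
    funext e
    simp [contractionDiff]

/-- Rank–nullity for `contractionDiff`: it is onto by simple connectedness, and its kernel is the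
line of constants by connectedness. This is the Euler characteristic of a tree. -/
theorem natCard_contraction [Finite V] [Nonempty V] {I : PathIdeal k V}
    (hπ : ∀ x : V, Subsingleton (FundamentalGroup I x))
    (hconn : ∀ a b : V, Relation.EqvGen Adj a b) {S : Set V}
    (hS : ∀ a b : V, Adj a b → b ∉ S) :
    Nat.card (Contraction S) = Nat.card (ContractionEdge S) + 1 := by
  have := Fintype.ofFinite (Contraction S)
  have := Fintype.ofFinite (ContractionEdge S)
  have h := LinearMap.finrank_range_add_finrank_ker (contractionDiff S)
  rw [LinearMap.range_eq_top.2 (contractionDiff_surjective hπ hconn hS),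
    Submodule.ext (mem_ker_contractionDiff_iff hconn (S := S)), finrank_top,
    finrank_span_singleton, Module.finrank_fintype_fun_eq_card,
    Module.finrank_fintype_fun_eq_card] at h
  · rw [Nat.card_eq_fintype_card, Nat.card_eq_fintype_card, h]
  · intro h0
    exact one_ne_zero (congrFun h0 (Contraction.mk S (Classical.arbitrary V)))

/-- The map on the contraction induced by an arrow-preserving self-map of a quiver. -/
def Contraction.map {S : Set V} (σ : V → V) (hσ : ∀ a b, Adj a b → Adj (σ a) (σ b))
    (hσS : ∀ a, σ a ∈ S ↔ a ∈ S) : Contraction S → Contraction S :=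
  Quot.map σ fun a b h => ⟨fun h' => h.1 ((hσS a).1 h'), hσ a b h.2⟩

/-- Otherwise `p` divides the number of vertices of the tree. It always divides the number of edges,
since a fixed edge would have a fixed end point in `S`. These numbers differ by one. -/
theorem exists_contraction_map_eq_self [Finite V] [Nonempty V] {I : PathIdeal k V}
    (hπ : ∀ x : V, Subsingleton (FundamentalGroup I x))
    (hconn : ∀ a b : V, Relation.EqvGen Adj a b) {S : Set V}
    (hS : ∀ a b : V, Adj a b → b ∉ S) {p : ℕ} (hp : p.Prime) (σ : V → V)
    (hσ : ∀ a b, Adj a b → Adj (σ a) (σ b)) (hσS : ∀ a, σ a ∈ S ↔ a ∈ S)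
    (hσp : ∀ a, σ^[p] a = a) (hfree : ∀ a, σ a ≠ a) :
    ∃ D : Contraction S, D.map σ hσ hσS = D := by
  by_contra! hD
  have hiter : ∀ (n : ℕ) (a : V),
      (Contraction.map σ hσ hσS)^[n] (Contraction.mk S a) = Contraction.mk S (σ^[n] a) := by
    intro n
    induction n with
    | zero => intro a; rfl
    | succ n ih =>
      intro a
      rw [Function.iterate_succ_apply, Function.iterate_succ_apply]
      exact ih (σ a)
  have hiterT : ∀ D, (Contraction.map σ hσ hσS)^[p] D = D := by
    intro D
    induction D using Contraction.ind with
    | h a => rw [hiter, hσp]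
  have h₁ : p ∣ Nat.card (Contraction S) :=
    prime_dvd_natCard_of_iterate_eq_id hp (Contraction.map σ hσ hσS) hiterT hD
  let τ : ContractionEdge S → ContractionEdge S := fun e =>
    ⟨(σ e.1.1, Contraction.map σ hσ hσS e.1.2), (hσS _).2 e.2.1, by
      obtain ⟨b, hb, hbe⟩ := e.2.2
      exact ⟨σ b, hσ _ _ hb, by rw [← hbe]; rfl⟩⟩
  have hτ : ∀ (n : ℕ) (e : ContractionEdge S), (τ^[n] e).1 =
      (σ^[n] e.1.1, (Contraction.map σ hσ hσS)^[n] e.1.2) := by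
    intro n
    induction n with
    | zero => intro e; rfl
    | succ n ih =>
      intro e
      rw [Function.iterate_succ_apply, ih]
      rfl
  have h₂ : p ∣ Nat.card (ContractionEdge S) :=
    prime_dvd_natCard_of_iterate_eq_id hp τ
      (fun e => Subtype.ext (by rw [hτ, hσp, hiterT]))
      fun e he => hfree e.1.1 (congrArg (fun e => e.1.1) he)
  rw [natCard_contraction hπ hconn hS] at h₁
  exact hp.one_lt.ne' (Nat.dvd_one.1 ((Nat.dvd_add_right h₂).1 h₁))

end Sources

end BoundQuiver

namespace BoundQuiver

theorem eqvGen_map {α β : Type*} {r : α → α → Prop} {s : β → β → Prop} (f : α → β)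
    (hf : ∀ a b, r a b → s (f a) (f b)) {a b : α} (h : Relation.EqvGen r a b) :
    Relation.EqvGen s (f a) (f b) := by
  induction h with
  | rel a b h => exact .rel _ _ (hf a b h)
  | refl a => exact .refl _
  | symm a b _ ih => exact .symm _ _ ih
  | trans a b c _ _ ih₁ ih₂ => exact .trans _ _ _ ih₁ ih₂

/-! ### Full subquivers, convex hulls and supports of walks -/

section FullSubquiver

variable {Q : Type u} [Quiver.{v} Q]

theorem mapPath_injective {V : Type u₁} [Quiver.{v₁} V] (φ : V ⥤q Q)
    (hφ : ∀ a, Function.Injective (φ.star a)) (a b : V) :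
    Function.Injective (φ.mapPath : Path a b → _) := by
  intro p q h
  have h' : φ.pathStar a ⟨b, p⟩ = φ.pathStar a ⟨b, q⟩ := congrArg (Sigma.mk _) h
  exact eq_of_heq (Sigma.mk.inj_iff.1 (φ.pathStar_injective hφ a h')).2

/-- The full subquiver on a set of vertices. -/
@[ext]
structure FullSubquiver (C : Set Q) : Type u where
  /-- the underlying vertex -/
  val : Q
  property : val ∈ C

instance (C : Set Q) : Quiver.{v} (FullSubquiver C) := ⟨fun a b => a.val ⟶ b.val⟩

/-- The inclusion of a full subquiver. -/
def fullSubquiverIncl (C : Set Q) : FullSubquiver C ⥤q Q where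
  obj a := a.val
  map e := e

/-- A set of vertices is convex if it contains all vertices of paths with end points in it. -/
def IsConvexSet (C : Set Q) : Prop :=
  ∀ ⦃a b c : Q⦄, Path a b → Path b c → a ∈ C → c ∈ C → b ∈ C

/-- A set of vertices is connected if its full subquiver is. -/
def IsConnectedSet (C : Set Q) : Prop :=
  ∀ a b : FullSubquiver C, Relation.EqvGen Adj a b

theorem fullSubquiverIncl_mapPath_injective (C : Set Q) (a b : FullSubquiver C) :
    Function.Injective ((fullSubquiverIncl C).mapPath : Path a b → _) := by
  refine mapPath_injective _ (fun a => ?_) a b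
  rintro ⟨⟨b, hb⟩, e⟩ ⟨⟨c, hc⟩, e'⟩ h
  obtain ⟨h₁, h₂⟩ := Sigma.mk.inj_iff.1 h
  obtain rfl : b = c := h₁
  obtain rfl : e = e' := eq_of_heq h₂
  rfl

theorem IsConvexSet.mapPath_surjective {C : Set Q} (hC : IsConvexSet C) (a b : FullSubquiver C) :
    Function.Surjective ((fullSubquiverIncl C).mapPath : Path a b → _) := by
  suffices h : ∀ (b : Q) (hb : b ∈ C) (p : Path a.val b), ∃ q : Path a (⟨b, hb⟩ : FullSubquiver C),
      (fullSubquiverIncl C).mapPath q = p from fun p => h b.val b.property p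
  intro b hb p
  induction p with
  | nil => exact ⟨Path.nil, rfl⟩
  | @cons c d p e ih =>
    obtain ⟨q, hq⟩ := ih (hC p e.toPath a.property hb)
    refine ⟨q.cons e, ?_⟩
    rw [Prefunctor.mapPath_cons, hq]
    rfl

theorem eqvGen_adj_of_path {a b : Q} (p : Path a b) : Relation.EqvGen Adj a b := by
  induction p with
  | nil => exact .refl _
  | cons p e ih => exact .trans _ _ _ ih (.rel _ _ ⟨e⟩)

theorem isConnectedSet_of_eqvGen {C : Set Q} (x : FullSubquiver C)
    (h : ∀ a : FullSubquiver C, Relation.EqvGen Adj x a) : IsConnectedSet C :=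
  fun a b => .trans _ _ _ (.symm _ _ (h a)) (h b)

theorem IsConnectedSet.eqvGen_of_subset {C D : Set Q} (hC : IsConnectedSet C) (hCD : C ⊆ D)
    {a b : Q} (ha : a ∈ C) (hb : b ∈ C) :
    Relation.EqvGen Adj (⟨a, hCD ha⟩ : FullSubquiver D) ⟨b, hCD hb⟩ :=
  eqvGen_map (a := ⟨a, ha⟩) (b := ⟨b, hb⟩)
    (fun x : FullSubquiver C => (⟨x.val, hCD x.property⟩ : FullSubquiver D)) (fun _ _ h => h)
    (hC ⟨a, ha⟩ ⟨b, hb⟩)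

/-- The vertices lying on paths with end points in `C`. -/
def hull (C : Set Q) : Set Q :=
  {b | ∃ a ∈ C, ∃ c ∈ C, Nonempty (Path a b) ∧ Nonempty (Path b c)}

theorem subset_hull (C : Set Q) : C ⊆ hull C :=
  fun a ha => ⟨a, ha, a, ha, ⟨Path.nil⟩, ⟨Path.nil⟩⟩

theorem isConvexSet_hull (C : Set Q) : IsConvexSet (hull C) := by
  rintro a b c p q ⟨a', ha', -, -, ⟨p'⟩, -⟩ ⟨-, -, c', hc', -, ⟨q'⟩⟩
  exact ⟨a', ha', c', hc', ⟨p'.comp p⟩, ⟨q.comp q'⟩⟩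

/-- The hull is covered by the vertices of the finitely many paths between points of `C`. -/
theorem finite_hull (hQ : ∀ a b : Q, Finite (Path a b)) {C : Set Q} (hC : C.Finite) :
    (hull C).Finite := by
  have h : (⋃ a ∈ C, ⋃ c ∈ C, ⋃ p : Path a c, {b | b ∈ p.vertices}).Finite := by
    refine hC.biUnion fun a _ => hC.biUnion fun c _ => ?_
    have := hQ a c
    exact Set.finite_iUnion fun p => List.finite_toSet _
  refine h.subset ?_
  rintro b ⟨a, ha, c, hc, ⟨p⟩, ⟨q⟩⟩
  simp only [Set.mem_iUnion]
  refine ⟨a, ha, c, hc, p.comp q, ?_⟩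
  change b ∈ (p.comp q).vertices
  rw [Path.vertices_comp]
  exact List.mem_append_right _ q.start_mem_vertices

theorem IsConnectedSet.hull {C : Set Q} (hC : IsConnectedSet C) : IsConnectedSet (hull C) := by
  intro a b
  have key : ∀ b : FullSubquiver (BoundQuiver.hull C), ∃ (c : Q) (hc : c ∈ C),
      Relation.EqvGen Adj (⟨c, subset_hull C hc⟩ : FullSubquiver (BoundQuiver.hull C)) b := by
    rintro ⟨b, c, hc, c', hc', ⟨p⟩, ⟨q⟩⟩
    obtain ⟨p', -⟩ := (isConvexSet_hull C).mapPath_surjective ⟨c, subset_hull C hc⟩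
      ⟨b, c, hc, c', hc', ⟨p⟩, ⟨q⟩⟩ p
    exact ⟨c, hc, eqvGen_adj_of_path p'⟩
  obtain ⟨c, hc, h⟩ := key a
  obtain ⟨c', hc', h'⟩ := key b
  exact .trans _ _ _ (.symm _ _ h)
    (.trans _ _ _ (hC.eqvGen_of_subset (subset_hull C) hc hc') h')

/-- A walk has a finite connected support, and it restricts to every set containing it. -/
theorem exists_support_walk {a b : Symmetrify Q} (u : Walk a b) :
    ∃ S : Set Q, S.Finite ∧ a ∈ S ∧ b ∈ S ∧ IsConnectedSet S ∧
      ∀ (C : Set Q), S ⊆ C → ∀ (ha : a ∈ C) (hb : b ∈ C),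
        ∃ t : Walk (Symmetrify.of.obj (⟨a, ha⟩ : FullSubquiver C))
          (Symmetrify.of.obj (⟨b, hb⟩ : FullSubquiver C)),
          (fullSubquiverIncl C).symmetrify.mapPath t = u := by
  induction u with
  | nil =>
    refine ⟨{a}, Set.finite_singleton _, rfl, rfl, ?_, fun C _ ha hb => ⟨Path.nil, rfl⟩⟩
    rintro ⟨b, rfl⟩ ⟨c, rfl⟩
    exact .refl _
  | @cons b c u e ih =>
    obtain ⟨S, hfin, ha, hb, hconn, hS⟩ := ih
    have hsub : S ⊆ insert c S := Set.subset_insert c S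
    refine ⟨insert c S, hfin.insert c, hsub ha, Set.mem_insert _ _, ?_, ?_⟩
    · refine isConnectedSet_of_eqvGen ⟨b, hsub hb⟩ ?_
      rintro ⟨d, hd⟩
      rcases hd with rfl | hd
      · rcases e with e | e
        · exact .rel _ _ ⟨e⟩
        · exact .symm _ _ (.rel _ _ ⟨e⟩)
      · exact hconn.eqvGen_of_subset hsub hb hd
    · intro C hC ha' hc'
      obtain ⟨t, ht⟩ := hS C (hsub.trans hC) ha' (hC (hsub hb))
      subst ht
      rcases e with e | e
      · exact ⟨t.cons (Sum.inl e), rfl⟩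
      · exact ⟨t.cons (Sum.inr e), rfl⟩

end FullSubquiver

theorem finite_fullSubquiver {Q : Type*} {C : Set Q} (hC : C.Finite) :
    Finite (FullSubquiver C) := by
  have := hC.to_subtype
  exact Finite.of_injective (fun a : FullSubquiver C => (⟨a.val, a.property⟩ : C)) fun a b h =>
    FullSubquiver.ext (congrArg Subtype.val h)

/-! ### Presentations of convex subcategories -/

section ConvexSubcategories

variable {k : Type w} [Field k] {A : Type u₁} [Category.{v₁} A] [Preadditive A] [Linear k A]
  {Q : Type u} [Quiver.{v} Q] (ν : Presentation k Q A)

/-- The objects of a presented category that correspond to the vertices in `C`. -/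
def Presentation.objectProperty (C : Set Q) : ObjectProperty A :=
  fun X => ∃ a ∈ C, ν.toPrefunctor.obj a = X

/-- The restriction of a presentation to the full subcategory on a set of vertices. -/
def Presentation.restrictPrefunctor (C : Set Q) :
    FullSubquiver C ⥤q (ν.objectProperty C).FullSubcategory where
  obj a := ⟨ν.toPrefunctor.obj a.val, a.val, a.property, rfl⟩
  map e := ObjectProperty.homMk (ν.toPrefunctor.map e)

theorem Presentation.hom_pathValue_restrictPrefunctor (C : Set Q) {a b : FullSubquiver C}
    (p : Path a b) : (pathValue (ν.restrictPrefunctor C) p).hom =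
      pathValue ν.toPrefunctor ((fullSubquiverIncl C).mapPath p) := by
  induction p with
  | nil => rfl
  | cons p e ih =>
    change (pathValue (ν.restrictPrefunctor C) p).hom ≫ ν.toPrefunctor.map e = _
    rw [ih]
    rfl

theorem Presentation.hom_eval_restrictPrefunctor (C : Set Q) {a b : FullSubquiver C}
    (f : PathSpace k a b) : (eval k (ν.restrictPrefunctor C) a b f).hom =
      eval k ν.toPrefunctor ((fullSubquiverIncl C).obj a) ((fullSubquiverIncl C).obj b)
        (Finsupp.mapDomain (fullSubquiverIncl C).mapPath f) := by
  induction f using Finsupp.induction_linear with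
  | zero => rw [Finsupp.mapDomain_zero, map_zero, map_zero]; rfl
  | add f g hf hg => rw [Finsupp.mapDomain_add, map_add, map_add, ← hf, ← hg]; rfl
  | single p c =>
    rw [Finsupp.mapDomain_single, eval, eval, Finsupp.linearCombination_single,
      Finsupp.linearCombination_single]
    erw [← ν.hom_pathValue_restrictPrefunctor]
    rfl

theorem Presentation.mem_kernelIdeal_restrictPrefunctor_iff (C : Set Q) {a b : FullSubquiver C}
    (f : PathSpace k a b) : f ∈ (kernelIdeal k (ν.restrictPrefunctor C)).carrier a b ↔
      Finsupp.mapDomain (fullSubquiverIncl C).mapPath f ∈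
        ν.ideal.carrier ((fullSubquiverIncl C).obj a) ((fullSubquiverIncl C).obj b) := by
  change eval k (ν.restrictPrefunctor C) a b f = 0 ↔
    eval k ν.toPrefunctor ((fullSubquiverIncl C).obj a)
    ((fullSubquiverIncl C).obj b) _ = 0
  rw [← ν.hom_eval_restrictPrefunctor]
  exact ⟨fun h => by rw [h]; rfl, fun h => ObjectProperty.hom_ext _ h⟩

/-- The presentation of the full subcategory on a convex set of vertices. -/
def Presentation.restrict {C : Set Q} (hC : IsConvexSet C) :
    Presentation k (FullSubquiver C) (ν.objectProperty C).FullSubcategory where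
  toPrefunctor := ν.restrictPrefunctor C
  isLocallyFinite := by
    refine ⟨fun a => ?_, fun a => ?_⟩
    · have := ν.isLocallyFinite.finite_star a.val
      refine Finite.of_injective (fun s : Quiver.Star a => (⟨s.1.val, s.2⟩ : Quiver.Star a.val)) ?_
      rintro ⟨⟨b, hb⟩, e⟩ ⟨⟨c, hc⟩, e'⟩ h
      obtain ⟨h₁, h₂⟩ := Sigma.mk.inj_iff.1 h
      obtain rfl : b = c := h₁
      obtain rfl : e = e' := eq_of_heq h₂
      rfl
    · have := ν.isLocallyFinite.finite_costar a.val
      refine Finite.of_injective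
        (fun s : Quiver.Costar a => (⟨s.1.val, s.2⟩ : Quiver.Costar a.val)) ?_
      rintro ⟨⟨b, hb⟩, e⟩ ⟨⟨c, hc⟩, e'⟩ h
      obtain ⟨h₁, h₂⟩ := Sigma.mk.inj_iff.1 h
      obtain rfl : b = c := h₁
      obtain rfl : e = e' := eq_of_heq h₂
      rfl
  bijective_obj := by
    constructor
    · intro a b h
      exact FullSubquiver.ext (ν.bijective_obj.1 (congrArg ObjectProperty.FullSubcategory.obj h))
    · rintro ⟨X, a, ha, rfl⟩
      exact ⟨⟨a, ha⟩, rfl⟩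
  surjective_eval a b g := by
    obtain ⟨f, hf⟩ := ν.surjective_eval a.val b.val g.hom
    obtain ⟨f', rfl⟩ := Finsupp.mapDomain_surjective (hC.mapPath_surjective a b) f
    exact ⟨f', ObjectProperty.hom_ext _ ((ν.hom_eval_restrictPrefunctor C f').trans hf)⟩
  isAdmissible := by
    refine ⟨fun a b f hf p hp => ?_, fun a => ?_, fun b => ?_⟩
    · classical
      rw [ν.mem_kernelIdeal_restrictPrefunctor_iff] at hf
      rw [← length_mapPath (fullSubquiverIncl C)]
      refine ν.isAdmissible.two_le_length _ _ _ hf _ ?_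
      rw [Finsupp.mapDomain_support_of_injective (fullSubquiverIncl_mapPath_injective C a b)]
      exact Finset.mem_image_of_mem _ hp
    · obtain ⟨N, hN⟩ := ν.isAdmissible.long_from a.val
      refine ⟨N, fun b p hp => ?_⟩
      rw [ν.mem_kernelIdeal_restrictPrefunctor_iff, Finsupp.mapDomain_single]
      exact hN _ _ ((length_mapPath (fullSubquiverIncl C) p).symm ▸ hp)
    · obtain ⟨N, hN⟩ := ν.isAdmissible.long_to b.val
      refine ⟨N, fun a p hp => ?_⟩
      rw [ν.mem_kernelIdeal_restrictPrefunctor_iff, Finsupp.mapDomain_single]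
      exact hN _ _ ((length_mapPath (fullSubquiverIncl C) p).symm ▸ hp)

theorem Presentation.reflectsIdeal_restrict {C : Set Q} (hC : IsConvexSet C) :
    ReflectsIdeal (fullSubquiverIncl C) (ν.restrict hC).ideal ν.ideal :=
  ⟨fullSubquiverIncl_mapPath_injective C, fun _ _ f =>
    ν.mem_kernelIdeal_restrictPrefunctor_iff C f⟩

variable {ν}

theorem Presentation.IsStronglySimplyConnected.subsingleton_fundamentalGroup
    (h : ν.IsStronglySimplyConnected) {C : Set Q} (hC : IsConvexSet C) (hfin : C.Finite)
    (x : FullSubquiver C) : Subsingleton (FundamentalGroup (ν.restrict hC).ideal x) := by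
  have : Finite (FullSubquiver C) := finite_fullSubquiver hfin
  refine h.isSimplyConnected (ν.objectProperty C)
    (Finite.of_surjective _ (ν.restrict hC).bijective_obj.2) ?_ (FullSubquiver C) (ν.restrict hC) x
  rintro a b c p q ⟨a', ha', ha⟩ ⟨c', hc', hc⟩
  obtain rfl := ν.bijective_obj.1 ha
  obtain rfl := ν.bijective_obj.1 hc
  exact ⟨b, hC p q ha' hc', rfl⟩

/-- The hull of the support of `u` is finite and convex, so `u` contracts inside it; the contraction
is then pushed to the whole quiver. This passes from the local hypothesis on finite convex
subcategories to all of `Q`. -/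
theorem Presentation.IsStronglySimplyConnected.homotopic_nil
    (h : ν.IsStronglySimplyConnected) {x : Q}
    (u : Walk (Symmetrify.of.obj x) (Symmetrify.of.obj x)) : Homotopic ν.ideal u Path.nil := by
  obtain ⟨S, hfin, hx, -, -, hS⟩ := exists_support_walk u
  obtain ⟨t, rfl⟩ := hS (hull S) (subset_hull S) (subset_hull S hx) (subset_hull S hx)
  have hsub := h.subsingleton_fundamentalGroup (isConvexSet_hull S) (finite_hull h.finite_path hfin)
    ⟨x, subset_hull S hx⟩
  have ht : Homotopic (ν.restrict (isConvexSet_hull S)).ideal t Path.nil :=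
    Quotient.exact (s := homotopySetoid _ _) (hsub.elim (Quotient.mk _ t) (Quotient.mk _ Path.nil))
  exact ht.map (ν.reflectsIdeal_restrict _)

/-! ### Descent to a stable component -/

/-- The set of sources of a quiver. -/
def sources (V : Type*) [Quiver V] : Set V := {a | ∀ b, ¬ Adj b a}

theorem sources_nonempty {V : Type*} [Quiver V] [Finite V] [Nonempty V] (hV : IsTriangular V) :
    (sources V).Nonempty := by
  let r : V → V → Prop := fun a b => ∃ p : Path a b, p.length ≠ 0
  have : IsTrans V r := ⟨fun a b c ⟨p, hp⟩ ⟨q, hq⟩ => ⟨p.comp q, by rw [Path.length_comp]; omega⟩⟩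
  have : Std.Irrefl r := ⟨fun a ⟨p, hp⟩ => hp (hV a p)⟩
  obtain ⟨m, -, hm⟩ := (Finite.wellFounded_of_trans_of_irrefl r).has_min Set.univ Set.univ_nonempty
  exact ⟨m, fun b ⟨e⟩ => hm b trivial ⟨e.toPath, one_ne_zero⟩⟩

open Classical in
/-- The source, if any, represented by a vertex of the contraction. -/
noncomputable def Contraction.source {V : Type u} [Quiver.{v} V]
    (D : Contraction (sources V)) : Option V :=
  Quot.lift (fun a => if a ∈ sources V then some a else none)
    (fun a b h => by
      rw [if_neg h.1, if_neg fun hb => hb a h.2]) D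

theorem Contraction.source_mk_of_mem {V : Type u} [Quiver.{v} V] {a : V} (ha : a ∈ sources V) :
    (Contraction.mk (sources V) a).source = some a := if_pos ha

theorem Contraction.source_mk_of_notMem {V : Type u} [Quiver.{v} V] {a : V}
    (ha : a ∉ sources V) : (Contraction.mk (sources V) a).source = none := if_neg ha

theorem Contraction.notMem_sources_of_mk_eq {V : Type u} [Quiver.{v} V] {a b : V}
    (ha : a ∉ sources V) (h : Contraction.mk (sources V) b = Contraction.mk (sources V) a) :
    b ∉ sources V := fun hb => by
  have h' := congrArg Contraction.source h
  rw [source_mk_of_mem hb, source_mk_of_notMem ha] at h'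
  exact absurd h' (by simp)

theorem Contraction.mk_eq_of_path {V : Type u} [Quiver.{v} V] {a b : V} (p : Path a b)
    (ha : a ∉ sources V) : Contraction.mk (sources V) b = Contraction.mk (sources V) a := by
  induction p with
  | nil => rfl
  | cons p e ih => exact (Contraction.sound (notMem_sources_of_mk_eq ha ih) ⟨e⟩).symm.trans ih

/-- The inverse of `σ` is its iterate of order `p - 1`, so it preserves arrows as well. -/
theorem apply_mem_sources_iff {V : Type*} [Quiver V] {σ : V → V}
    (hσ : ∀ a b, Adj a b → Adj (σ a) (σ b)) {p : ℕ} (hp : p ≠ 0) (hσp : ∀ a, σ^[p] a = a) (a : V) :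
    σ a ∈ sources V ↔ a ∈ sources V := by
  have hiter : ∀ (n : ℕ) (a b : V), Adj a b → Adj (σ^[n] a) (σ^[n] b) := by
    intro n
    induction n with
    | zero => exact fun _ _ h => h
    | succ n ih => exact fun a b h => ih _ _ (hσ a b h)
  constructor
  · exact fun h b hb => h (σ b) (hσ _ _ hb)
  · intro h b hb
    obtain ⟨n, rfl⟩ := Nat.exists_eq_succ_of_ne_zero hp
    refine h (σ^[n] b) ?_
    have h' := hiter n _ _ hb
    rwa [← Function.iterate_succ_apply, hσp] at h'

/-- In a strongly simply connected category, no map of prime order without fixed points stabilizes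
a finite connected convex set of vertices. -/
theorem Presentation.IsStronglySimplyConnected.not_isConnectedSet
    (h : ν.IsStronglySimplyConnected) {p : ℕ} (hp : p.Prime) {σ : Q → Q}
    (hσ : ∀ a b, Adj a b → Adj (σ a) (σ b)) (hσp : ∀ a, σ^[p] a = a) (hfree : ∀ a, σ a ≠ a)
    {C : Set Q} (hfin : C.Finite) (hne : C.Nonempty) (hconv : IsConvexSet C)
    (hstable : ∀ a ∈ C, σ a ∈ C) : ¬ IsConnectedSet C := by
  induction hn : C.ncard using Nat.strong_induction_on generalizing C with
  | _ n ih =>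
  intro hconn
  have : Finite (FullSubquiver C) := finite_fullSubquiver hfin
  have : Nonempty (FullSubquiver C) := let ⟨a, ha⟩ := hne; ⟨⟨a, ha⟩⟩
  let τ : FullSubquiver C → FullSubquiver C := fun a => ⟨σ a.val, hstable a.val a.property⟩
  have hτ : ∀ a b, Adj a b → Adj (τ a) (τ b) := fun a b hab => hσ a.val b.val hab
  have hτp : ∀ a, τ^[p] a = a := by
    have hiter : ∀ (n : ℕ) (a : FullSubquiver C), (τ^[n] a).1 = σ^[n] a.val := by
      intro n
      induction n with
      | zero => exact fun _ => rfl
      | succ n ih => exact fun a => ih (τ a)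
    exact fun a => FullSubquiver.ext ((hiter p a).trans (hσp a.val))
  have hτfree : ∀ a, τ a ≠ a := fun a ha => hfree a.val (congrArg FullSubquiver.val ha)
  obtain ⟨D, hD⟩ := exists_contraction_map_eq_self
    (h.subsingleton_fundamentalGroup hconv hfin) hconn (S := sources (FullSubquiver C))
    (fun a b hab hb => hb a hab) hp τ hτ (apply_mem_sources_iff hτ hp.ne_zero hτp) hτp hτfree
  induction D using Contraction.ind with
  | h x =>
  -- A source is alone in its class, so a fixed class represented by a source would give a fixed
  -- vertex.
  have hx : x ∉ sources (FullSubquiver C) := by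
    intro hx
    have h' := congrArg Contraction.source hD
    have hτx := (apply_mem_sources_iff hτ hp.ne_zero hτp x).2 hx
    rw [Contraction.source_mk_of_mem hx] at h'
    exact hτfree x (Option.some.inj ((Contraction.source_mk_of_mem hτx).symm.trans h'))
  let C' : Set Q := {a | ∃ ha : a ∈ C, Contraction.mk (sources (FullSubquiver C)) ⟨a, ha⟩ =
    Contraction.mk _ x}
  have hsub : C' ⊆ C := fun a ha => ha.1
  obtain ⟨s, hs⟩ := sources_nonempty (V := FullSubquiver C) fun a p => by
    rw [← length_mapPath (fullSubquiverIncl C)]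
    exact h.isTriangular _ _
  have hssub : C' ⊂ C := ⟨hsub, fun hle =>
    Contraction.notMem_sources_of_mk_eq hx (hle s.property).2 hs⟩
  refine ih C'.ncard (hn ▸ Set.ncard_lt_ncard hssub hfin) (hfin.subset hsub)
    ⟨x.val, x.property, rfl⟩
    ?_ ?_ rfl ?_
  -- Convexity of `C` keeps the path in `C`, and a path in `C` starting at a non-source never leaves
  -- its component.
  · rintro a b c p q ⟨ha, ha'⟩ ⟨hc, -⟩
    have hb := hconv p q ha hc
    obtain ⟨p', -⟩ := hconv.mapPath_surjective ⟨a, ha⟩ ⟨b, hb⟩ p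
    exact ⟨hb, (Contraction.mk_eq_of_path p'
      (Contraction.notMem_sources_of_mk_eq hx ha')).trans ha'⟩
  · rintro a ⟨ha, ha'⟩
    exact ⟨hstable a ha, (congrArg (Contraction.map τ hτ
      (apply_mem_sources_iff hτ hp.ne_zero hτp)) ha').trans hD⟩
  -- Equality in the quotient yields a zigzag of arrows; its intermediate vertices have the same
  -- class, so the zigzag runs inside `C'`.
  · have key : ∀ a b : FullSubquiver C, Relation.EqvGen
        (fun a b : FullSubquiver C => a ∉ sources (FullSubquiver C) ∧ Adj a b) a b →
        ∀ (ha : a.val ∈ C') (hb : b.val ∈ C'),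
          Relation.EqvGen Adj (⟨a.val, ha⟩ : FullSubquiver C') ⟨b.val, hb⟩ := by
      intro a b hab
      induction hab with
      | rel a b hab => exact fun ha hb => .rel _ _ hab.2
      | refl a => exact fun ha hb => .refl _
      | symm a b _ ih => exact fun ha hb => .symm _ _ (ih hb ha)
      | trans a b c hab _ ih₁ ih₂ =>
        intro ha hc
        have hb : b.val ∈ C' := ⟨b.property, (Quot.eqvGen_sound hab).symm.trans ha.2⟩
        exact .trans _ _ _ (ih₁ ha hb) (ih₂ hb hc)
    rintro ⟨a, ha⟩ ⟨b, hb⟩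
    exact key ⟨a, ha.1⟩ ⟨b, hb.1⟩ (Quot.eqvGen_exact (ha.2.trans hb.2.symm)) ha hb

end ConvexSubcategories

end BoundQuiver

namespace BoundQuiver

/-! ### Lifting walks along coverings of quivers -/

section Lifts

variable {Q' : Type u₁} [Quiver.{v₁} Q'] {Q : Type u} [Quiver.{v} Q]

/-- The walk `u` lifts along `F` to a walk from `x'` to `y'`. -/
def LiftsTo (F : Q' ⥤q Q) {a b : Symmetrify Q} (u : Walk a b) (x' y' : Symmetrify Q') : Prop :=
  ∃ (w : Walk x' y') (hx : F.symmetrify.obj x' = a) (hy : F.symmetrify.obj y' = b),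
    (F.symmetrify.mapPath w).cast hx hy = u

variable {F : Q' ⥤q Q}

theorem LiftsTo.obj_left {a b : Symmetrify Q} {u : Walk a b} {x' y' : Symmetrify Q'}
    (h : LiftsTo F u x' y') : F.symmetrify.obj x' = a := h.choose_spec.choose

theorem liftsTo_mapPath {x' y' : Symmetrify Q'} (w : Walk x' y') :
    LiftsTo F (F.symmetrify.mapPath w) x' y' := ⟨w, rfl, rfl, rfl⟩

theorem exists_liftsTo (hF : F.IsCovering) {a b : Symmetrify Q} (u : Walk a b)
    {x' : Symmetrify Q'} (hx : F.symmetrify.obj x' = a) : ∃ y', LiftsTo F u x' y' := by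
  subst hx
  obtain ⟨⟨y', w⟩, hw⟩ := (hF.symmetrify.pathStar_bijective x').2 ⟨b, u⟩
  obtain ⟨h₁, h₂⟩ := Sigma.mk.inj_iff.1 hw
  subst h₁
  obtain rfl := eq_of_heq h₂
  exact ⟨y', liftsTo_mapPath w⟩

theorem LiftsTo.right_unique (hF : F.IsCovering) {a b : Symmetrify Q} {u : Walk a b}
    {x' y' z' : Symmetrify Q'} (h₁ : LiftsTo F u x' y') (h₂ : LiftsTo F u x' z') : y' = z' := by
  obtain ⟨w₁, rfl, rfl, rfl⟩ := h₁
  obtain ⟨w₂, _, hy, h⟩ := h₂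
  have h' : F.symmetrify.pathStar x' ⟨z', w₂⟩ = F.symmetrify.pathStar x' ⟨y', w₁⟩ :=
    Sigma.mk.inj_iff.2 ⟨hy, (Path.cast_eq_iff_heq _ _ _ _).1 h⟩
  exact (Sigma.mk.inj_iff.1 ((hF.symmetrify.pathStar_bijective x').1 h')).1.symm

theorem LiftsTo.comp {a b c : Symmetrify Q} {u : Walk a b} {v : Walk b c}
    {x' y' z' : Symmetrify Q'} (hu : LiftsTo F u x' y') (hv : LiftsTo F v y' z') :
    LiftsTo F (u.comp v) x' z' := by
  obtain ⟨w₁, rfl, rfl, rfl⟩ := hu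
  obtain ⟨w₂, -, rfl, rfl⟩ := hv
  exact ⟨w₁.comp w₂, rfl, rfl, Prefunctor.mapPath_comp _ _ _⟩

theorem LiftsTo.of_comp (hF : F.IsCovering) {a b c : Symmetrify Q} {u : Walk a b} {v : Walk b c}
    {x' z' : Symmetrify Q'} (h : LiftsTo F (u.comp v) x' z') :
    ∃ y', LiftsTo F u x' y' ∧ LiftsTo F v y' z' := by
  obtain ⟨y', hy'⟩ := exists_liftsTo hF u h.obj_left
  obtain ⟨w, -, hy, -⟩ := id hy'
  obtain ⟨t, ht⟩ := exists_liftsTo hF v hy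
  obtain rfl := (hy'.comp ht).right_unique hF h
  exact ⟨y', hy', ht⟩

theorem mapPath_reverse {U V : Type*} [Quiver U] [Quiver V] [HasReverse U] [HasReverse V]
    (φ : U ⥤q V) [φ.MapReverse] {a b : U} (p : Path a b) :
    φ.mapPath p.reverse = (φ.mapPath p).reverse := by
  induction p with
  | nil => rfl
  | cons p e ih =>
    rw [Path.reverse, Prefunctor.mapPath_comp, ih, Prefunctor.mapPath_toPath,
      Prefunctor.map_reverse]
    rfl

theorem LiftsTo.reverse {a b : Symmetrify Q} {u : Walk a b} {x' y' : Symmetrify Q'}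
    (h : LiftsTo F u x' y') : LiftsTo F u.reverse y' x' := by
  obtain ⟨w, rfl, rfl, rfl⟩ := h
  exact ⟨w.reverse, rfl, rfl, mapPath_reverse _ _⟩

/-- If the paths in each minimal relation lift to paths with common end points, then homotopic
walks lift to walks with the same end points. -/
theorem Homotopic.liftsTo_iff {k : Type w} [Field k] {I : PathIdeal k Q} (hF : F.IsCovering)
    (hrel : ∀ (a b : Q) (ρ : PathSpace k a b), I.IsMinimalRelation ρ → ∀ p ∈ ρ.support,
      ∀ q ∈ ρ.support, ∀ x' y', LiftsTo F (Walk.ofPath p) x' y' → LiftsTo F (Walk.ofPath q) x' y')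
    {a b : Symmetrify Q} {u v : Walk a b} (h : Homotopic I u v) :
    ∀ x' y', LiftsTo F u x' y' ↔ LiftsTo F v x' y' := by
  induction h with
  | refl u => exact fun _ _ => Iff.rfl
  | symm _ ih => exact fun _ _ => (ih _ _).symm
  | trans _ _ ih₁ ih₂ => exact fun _ _ => (ih₁ _ _).trans (ih₂ _ _)
  | @cancel a b e =>
    have key : ∀ x' : Symmetrify Q', F.symmetrify.obj x' = a →
        LiftsTo F (e.toPath.comp (Quiver.reverse e).toPath) x' x' := by
      intro x' hx'
      obtain ⟨y', hy'⟩ := exists_liftsTo hF e.toPath hx'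
      have h := hy'.reverse
      rw [Path.reverse_toPath] at h
      exact hy'.comp h
    intro x' y'
    constructor
    · intro h
      obtain rfl := (key x' h.obj_left).right_unique hF h
      exact ⟨Path.nil, h.obj_left, h.obj_left, Path.cast_nil _⟩
    · rintro h
      obtain ⟨w, hx, hy, hw⟩ := id h
      have h' : LiftsTo F (Path.nil : Walk a a) x' x' := ⟨Path.nil, hx, hx, Path.cast_nil _⟩
      obtain rfl := h'.right_unique hF h
      exact key x' hx
  | relation ρ hρ p q hp hq =>
    exact fun x' y' => ⟨hrel _ _ ρ hρ p hp q hq x' y', hrel _ _ ρ hρ q hq p hp x' y'⟩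
  | congr w₁ w₂ _ ih =>
    intro x' y'
    constructor <;> intro h
    · obtain ⟨z₂, h₁₂, h₃⟩ := h.of_comp hF
      obtain ⟨z₁, h₁, h₂⟩ := h₁₂.of_comp hF
      exact (h₁.comp ((ih _ _).1 h₂)).comp h₃
    · obtain ⟨z₂, h₁₂, h₃⟩ := h.of_comp hF
      obtain ⟨z₁, h₁, h₂⟩ := h₁₂.of_comp hF
      exact (h₁.comp ((ih _ _).2 h₂)).comp h₃

theorem exists_path_cast (hF : F.IsCovering) {x' : Q'} {b : Q} (p : Path (F.obj x') b) :
    ∃ (y' : {y' : Q' // F.obj y' = b}) (p' : Path x' y'.1), (F.mapPath p').cast rfl y'.2 = p := by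
  obtain ⟨⟨y', p'⟩, h⟩ := (hF.pathStar_bijective x').2 ⟨b, p⟩
  obtain ⟨h₁, h₂⟩ := Sigma.mk.inj_iff.1 h
  exact ⟨⟨y', h₁⟩, p', (Path.cast_eq_iff_heq _ _ _ _).2 h₂⟩

theorem liftsTo_ofPath_cast {x' y' : Q'} {b : Q} (p : Path x' y') (hy : F.obj y' = b) :
    LiftsTo F (Walk.ofPath ((F.mapPath p).cast rfl hy)) x' y' := by
  subst hy
  exact ⟨Walk.ofPath p, rfl, rfl, symmetrify_mapPath_ofPath F p⟩

end Lifts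

/-! ### Relations and group action under a Galois covering -/

section GaloisCovering

variable {k : Type w} [Field k] {Q' : Type u₁} [Quiver.{v₁} Q'] {Q : Type u} [Quiver.{v} Q]
  {F : Q' ⥤q Q} {I' : PathIdeal k Q'} {I : PathIdeal k Q}

/-- The quotient map `kQ(a, b) → (kQ/I)(a, b)`. -/
noncomputable def PathIdeal.quotMk (I : PathIdeal k Q) (a b : Q) :
    PathSpace k a b →ₗ[k] I.QuotHom a b :=
  (I.carrier a b).mkQ

theorem PathIdeal.quotMk_eq_zero (I : PathIdeal k Q) {a b : Q} {f : PathSpace k a b} :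
    I.quotMk a b f = 0 ↔ f ∈ I.carrier a b := Submodule.Quotient.mk_eq_zero _

theorem PathIdeal.quotMk_single (I : PathIdeal k Q) {a b : Q} (p : Path a b) (c : k) :
    I.quotMk a b (Finsupp.single p c) = c • I.quotMk a b (Finsupp.single p 1) := by
  rw [← map_smul, Finsupp.smul_single, smul_eq_mul, mul_one]

theorem MapsIdeal.mapHom_quotMk (h : MapsIdeal F I' I) {x' y' : Q'} {x y : Q} (hx : F.obj x' = x)
    (hy : F.obj y' = y) (f : PathSpace k x' y') :
    h.mapHom hx hy (I'.quotMk x' y' f) = I.quotMk x y (push k F hx hy f) := rfl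

open Classical in
/-- The component, for a vertex over `b`, of the preimage of a class in `(kQ/I)(F x', b)` under the
covering map is mapped to the part of the class supported on paths lifting to that component. -/
theorem filter_mem_of_mem (h : MapsIdeal F I' I) (hcov : F.IsCovering) {x' : Q'} {b : Q}
    (hout : Function.Injective (h.coverOut x' b)) {ρ : PathSpace k (F.obj x') b}
    (hρ : ρ ∈ I.carrier (F.obj x') b) (y' : {y' : Q' // F.obj y' = b}) :
    ρ.filter (fun p => LiftsTo F (Walk.ofPath p) x' y'.1) ∈ I.carrier (F.obj x') b := by
  choose t p' hp' using fun p : Path (F.obj x') b => exists_path_cast hcov p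
  -- `Λ` lifts each path from `x'` and sorts it by the end point of its lift. It is a section of
  -- `coverOut` modulo the ideal, so injectivity kills `Λ ρ` and with it every component.
  let Λ : PathSpace k (F.obj x') b →ₗ[k]
      (DirectSum {y' : Q' // F.obj y' = b} fun y' => I'.QuotHom x' y'.1) :=
    Finsupp.linearCombination k fun p =>
      DirectSum.lof k _ (fun y' : {y' : Q' // F.obj y' = b} => I'.QuotHom x' y'.1) (t p)
        (I'.quotMk x' (t p).1 (Finsupp.single (p' p) 1))
  have hmap : ∀ p, h.mapHom rfl (t p).2 (I'.quotMk x' (t p).1 (Finsupp.single (p' p) 1)) =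
      I.quotMk (F.obj x') b (Finsupp.single p 1) := by
    intro p
    rw [h.mapHom_quotMk, push, Finsupp.lmapDomain_apply, Finsupp.mapDomain_single, hp']
  have hΛ : ∀ f, h.coverOut x' b (Λ f) = I.quotMk (F.obj x') b f := by
    intro f
    induction f using Finsupp.induction_linear with
    | zero => rw [map_zero, map_zero, map_zero]
    | add f g hf hg => rw [map_add, map_add, map_add, hf, hg]
    | single p c =>
      rw [Finsupp.linearCombination_single, map_smul, MapsIdeal.coverOut, DirectSum.toModule_lof,
        hmap, I.quotMk_single p c]
  have hcomp : ∀ f, h.mapHom rfl y'.2 (Λ f y') = I.quotMk (F.obj x') b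
      (f.filter (fun p => LiftsTo F (Walk.ofPath p) x' y'.1)) := by
    intro f
    induction f using Finsupp.induction_linear with
    | zero => rw [map_zero, DirectSum.zero_apply, map_zero, Finsupp.filter_zero, map_zero]
    | add f g hf hg =>
      rw [map_add, DirectSum.add_apply, map_add, Finsupp.filter_add, map_add, hf, hg]
    | single p c =>
      have hlift : LiftsTo F (Walk.ofPath p) x' (t p).1 := by
        have := liftsTo_ofPath_cast (p' p) (t p).2
        rwa [hp'] at this
      rw [Finsupp.linearCombination_single, DirectSum.smul_apply, map_smul]
      by_cases hty : t p = y'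
      · subst hty
        rw [DirectSum.lof_apply, hmap,
          Finsupp.filter_single_of_pos (fun q => LiftsTo F (Walk.ofPath q) x' _) hlift,
          I.quotMk_single p c]
      · rw [Finsupp.filter_single_of_neg (fun q => LiftsTo F (Walk.ofPath q) x' y'.1) fun hl =>
            hty (Subtype.ext (hlift.right_unique hcov hl)), DirectSum.lof_eq_of,
          DirectSum.of_eq_of_ne _ _ _ (Ne.symm hty), map_zero, smul_zero, map_zero]
  have h0 : Λ ρ = 0 := hout (by
    rw [hΛ, map_zero]
    exact I.quotMk_eq_zero.2 hρ)
  have h1 := hcomp ρ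
  rw [h0, DirectSum.zero_apply, map_zero] at h1
  exact I.quotMk_eq_zero.1 h1.symm

/-- The part of `ρ` on paths lifting to walks from `x'` to `y'` lies in the ideal and contains `p`;
by minimality it is all of `ρ`. -/
theorem liftsTo_of_isMinimalRelation (h : MapsIdeal F I' I) (hcov : F.IsCovering)
    (hout : ∀ x' y, Function.Injective (h.coverOut x' y)) {a b : Q} {ρ : PathSpace k a b}
    (hρ : I.IsMinimalRelation ρ) {p q : Path a b} (hp : p ∈ ρ.support) (hq : q ∈ ρ.support)
    {x' y' : Symmetrify Q'} (hl : LiftsTo F (Walk.ofPath p) x' y') :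
    LiftsTo F (Walk.ofPath q) x' y' := by
  classical
  obtain ⟨-, hx, hy, -⟩ := id hl
  change F.obj x' = a at hx
  change F.obj y' = b at hy
  subst hx
  by_contra hq'
  refine hρ.subsum_notMem (ρ.support.filter fun p => LiftsTo F (Walk.ofPath p) x' y')
    ⟨p, Finset.mem_filter.2 ⟨hp, hl⟩⟩
    ⟨Finset.filter_subset _ _, fun hle => hq' (Finset.mem_filter.1 (hle hq)).2⟩ ?_
  have := filter_mem_of_mem h hcov (hout x' b) hρ.mem ⟨y', hy⟩
  rwa [Finsupp.filter_eq_sum] at this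

/-- A class upstairs is a single summand in the domain of `coverOut`, so it vanishes as soon as its
image does. This allows homotopies to be projected along the covering. -/
theorem reflectsIdeal_of_injective_coverOut (h : MapsIdeal F I' I) (hcov : F.IsCovering)
    (hout : ∀ x' y, Function.Injective (h.coverOut x' y)) : ReflectsIdeal F I' I := by
  classical
  refine ⟨mapPath_injective F fun a => (hcov.star_bijective a).1, fun x' y' f =>
    ⟨fun hf => h x' y' f hf, fun hf => ?_⟩⟩
  have h0 : h.coverOut x' (F.obj y') (DirectSum.lof k _
      (fun z : {z : Q' // F.obj z = F.obj y'} => I'.QuotHom x' z.1) ⟨y', rfl⟩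
      (I'.quotMk x' y' f)) = 0 := by
    rw [MapsIdeal.coverOut, DirectSum.toModule_lof]
    exact (h.mapHom_quotMk rfl rfl f).trans (I.quotMk_eq_zero.2 hf)
  have h1 := hout x' (F.obj y') (h0.trans (map_zero _).symm)
  have h2 := DirectSum.of_injective
    (β := fun z : {z : Q' // F.obj z = F.obj y'} => I'.QuotHom x' z.1)
    ⟨y', rfl⟩ (h1.trans (map_zero (DirectSum.of _ _)).symm)
  exact I'.quotMk_eq_zero.1 h2

variable {G : Type u₂} [Group G] {ρ : QuiverAction G Q'}

theorem QuiverAction.one_obj (ρ : QuiverAction G Q') (x : Q') : (ρ.act 1).obj x = x := by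
  rw [ρ.act_one]; rfl

theorem QuiverAction.mul_obj (ρ : QuiverAction G Q') (g h : G) (x : Q') :
    (ρ.act (g * h)).obj x = (ρ.act g).obj ((ρ.act h).obj x) := by
  rw [ρ.act_mul]; rfl

theorem QuiverAction.iterate_obj (ρ : QuiverAction G Q') (g : G) (n : ℕ) (x : Q') :
    (ρ.act g).obj^[n] x = (ρ.act (g ^ n)).obj x := by
  induction n generalizing x with
  | zero => rw [pow_zero, ρ.one_obj]; rfl
  | succ n ih => rw [Function.iterate_succ_apply, ih, pow_succ, ρ.mul_obj]

theorem arrowMap_comp {V : Type u'} [Quiver.{v'} V] (φ : Q' ⥤q Q) (ψ : Q ⥤q V)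
    (α : Quiver.Total Q') : arrowMap (φ ⋙q ψ) α = arrowMap ψ (arrowMap φ α) := rfl

theorem total_mk_eq_star_iff {V : Type*} [Quiver V] {a : V} (s t : Quiver.Star a) :
    (⟨a, s.1, s.2⟩ : Quiver.Total V) = ⟨a, t.1, t.2⟩ ↔ s = t := by
  constructor
  · rintro h
    obtain ⟨b, e⟩ := s
    obtain ⟨c, e'⟩ := t
    simp only [Quiver.Total.mk.injEq, true_and] at h
    exact Sigma.mk.inj_iff.2 h
  · rintro rfl
    rfl

theorem total_mk_eq_costar_iff {V : Type*} [Quiver V] {a : V} (s t : Quiver.Costar a) :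
    (⟨s.1, a, s.2⟩ : Quiver.Total V) = ⟨t.1, a, t.2⟩ ↔ s = t := by
  constructor
  · rintro h
    obtain ⟨b, e⟩ := s
    obtain ⟨c, e'⟩ := t
    simp only [Quiver.Total.mk.injEq, true_and] at h
    exact Sigma.mk.inj_iff.2 h
  · rintro rfl
    rfl

/-- Lifts of an arrow at a given vertex exist because a lift elsewhere can be translated there, and
are unique because two of them differ by a group element fixing that vertex. -/
theorem IsGaloisCovering.isCovering (hF : IsGaloisCovering ρ F I' I) : F.IsCovering := by
  have hact : ∀ (g : G) (α : Quiver.Total Q'), arrowMap F (arrowMap (ρ.act g) α) = arrowMap F α :=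
    fun g α => by rw [← arrowMap_comp, hF.act_comp]
  have hone : ∀ α : Quiver.Total Q', arrowMap (ρ.act 1) α = α := fun α => by
    rw [ρ.act_one]; rfl
  constructor
  · refine fun a => ⟨fun s t h => ?_, fun s => ?_⟩
    · obtain ⟨g, hg⟩ := hF.orbit_arrow ⟨a, s.1, s.2⟩ ⟨a, t.1, t.2⟩
        ((total_mk_eq_star_iff (F.star a s) (F.star a t)).2 h)
      obtain rfl := hF.free g a (congrArg Quiver.Total.left hg)
      rw [hone] at hg
      exact (total_mk_eq_star_iff s t).1 hg
    · obtain ⟨α, hα⟩ := hF.surjective_arrow ⟨F.obj a, s.1, s.2⟩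
      obtain ⟨g, hg⟩ := hF.orbit_obj α.left a (congrArg Quiver.Total.left hα)
      rw [← hact g] at hα
      generalize hβ : arrowMap (ρ.act g) α = β at hα
      obtain ⟨b, c, e⟩ := β
      obtain rfl : b = a := (congrArg Quiver.Total.left hβ).symm.trans hg
      exact ⟨⟨c, e⟩, (total_mk_eq_star_iff (F.star b ⟨c, e⟩) s).1 hα⟩
  · refine fun a => ⟨fun s t h => ?_, fun s => ?_⟩
    · obtain ⟨g, hg⟩ := hF.orbit_arrow ⟨s.1, a, s.2⟩ ⟨t.1, a, t.2⟩
        ((total_mk_eq_costar_iff (F.costar a s) (F.costar a t)).2 h)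
      obtain rfl := hF.free g a (congrArg Quiver.Total.right hg)
      rw [hone] at hg
      exact (total_mk_eq_costar_iff s t).1 hg
    · obtain ⟨α, hα⟩ := hF.surjective_arrow ⟨s.1, F.obj a, s.2⟩
      obtain ⟨g, hg⟩ := hF.orbit_obj α.right a (congrArg Quiver.Total.right hα)
      rw [← hact g] at hα
      generalize hβ : arrowMap (ρ.act g) α = β at hα
      obtain ⟨b, c, e⟩ := β
      obtain rfl : c = a := (congrArg Quiver.Total.right hβ).symm.trans hg
      exact ⟨⟨b, e⟩, (total_mk_eq_costar_iff (F.costar c ⟨b, e⟩) s).1 hα⟩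

theorem IsGaloisCovering.liftsTo_iff (hF : IsGaloisCovering ρ F I' I) {a b : Symmetrify Q}
    {u v : Walk a b} (h : Homotopic I u v) (x' y' : Symmetrify Q') :
    LiftsTo F u x' y' ↔ LiftsTo F v x' y' :=
  h.liftsTo_iff hF.isCovering (fun _ _ _ hρ _ hp _ hq _ _ hl =>
    liftsTo_of_isMinimalRelation hF.mapsIdeal hF.isCovering
      (fun x' y => (hF.bijective_coverOut x' y).1) hρ hp hq hl) x' y'

theorem symmetrify_comp {V : Type u'} [Quiver.{v'} V] (φ : Q' ⥤q Q) (ψ : Q ⥤q V) :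
    (φ ⋙q ψ).symmetrify = φ.symmetrify ⋙q ψ.symmetrify := by
  refine Prefunctor.ext (fun _ => rfl) fun a b e => ?_
  rcases e with e | e <;> rfl

theorem IsGaloisCovering.liftsTo_act (hF : IsGaloisCovering ρ F I' I) {a b : Symmetrify Q}
    {u : Walk a b} {x' y' : Symmetrify Q'} (h : LiftsTo F u x' y') (g : G) :
    LiftsTo F u ((ρ.act g).symmetrify.obj x') ((ρ.act g).symmetrify.obj y') := by
  obtain ⟨w, rfl, rfl, rfl⟩ := h
  have hg : (ρ.act g).symmetrify ⋙q F.symmetrify = F.symmetrify := by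
    rw [← symmetrify_comp, hF.act_comp]
  refine ⟨(ρ.act g).symmetrify.mapPath w, congrArg (fun φ => φ.obj x') hg,
    congrArg (fun φ => φ.obj y') hg, ?_⟩
  have key : ∀ φ : Symmetrify Q' ⥤q Symmetrify Q, φ = F.symmetrify →
      HEq (φ.mapPath w) (F.symmetrify.mapPath w) := by
    rintro _ rfl
    rfl
  exact (Path.cast_eq_iff_heq _ _ _ _).2
    ((heq_of_eq (Prefunctor.mapPath_comp_apply _ _ w).symm).trans (key _ hg))

/-- The iterated concatenation of a closed walk with itself. -/
def Walk.npow {x : Symmetrify Q} (u : Walk x x) : ℕ → Walk x x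
  | 0 => Path.nil
  | n + 1 => u.comp (Walk.npow u n)

/-- The lift of `u` is followed by the `g`-translate of the lift of the remaining power, which
starts at `g x'`. -/
theorem IsGaloisCovering.liftsTo_npow (hF : IsGaloisCovering ρ F I' I) {x : Symmetrify Q}
    {u : Walk x x} {x' : Symmetrify Q'} {g : G}
    (h : LiftsTo F u x' ((ρ.act g).obj x')) (n : ℕ) :
    LiftsTo F (u.npow n) x' ((ρ.act (g ^ n)).obj x') := by
  induction n with
  | zero =>
    have h0 : (ρ.act (g ^ 0)).obj x' = x' := by
      rw [pow_zero]
      exact ρ.one_obj x'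
    exact (congrArg (LiftsTo F (u.npow 0) x') h0).mpr
      ⟨Path.nil, h.obj_left, h.obj_left, Path.cast_nil _⟩
  | succ n ih =>
    rw [pow_succ']
    exact (congrArg (LiftsTo F (u.npow (n + 1)) x') (ρ.mul_obj g (g ^ n) x')).mpr
      (h.comp (hF.liftsTo_act ih g))

/-- The class of a closed walk in the fundamental group. -/
def FundamentalGroup.mk (I : PathIdeal k Q) (x : Q)
    (u : Walk (Symmetrify.of.obj x) (Symmetrify.of.obj x)) : FundamentalGroup I x :=
  Quotient.mk (homotopySetoid I x) u

theorem FundamentalGroup.mk_npow (x : Q) (u : Walk (Symmetrify.of.obj x) (Symmetrify.of.obj x))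
    (n : ℕ) : mk I x (u.npow n) = mk I x u ^ n := by
  induction n with
  | zero => rw [pow_zero]; rfl
  | succ n ih => rw [pow_succ', ← ih]; rfl

/-- Consecutive translates of `S` meet in a translate of `σ x`. -/
theorem IsConnectedSet.iUnion_image {V : Type u} [Quiver.{v} V] {σ : V → V}
    (hσ : ∀ a b, Adj a b → Adj (σ a) (σ b)) {S : Set V} (hS : IsConnectedSet S) {x : V}
    (hx : x ∈ S) (hσx : σ x ∈ S) : IsConnectedSet (⋃ n : ℕ, σ^[n] '' S) := by
  have hsub : S ⊆ ⋃ n : ℕ, σ^[n] '' S := fun a ha => Set.mem_iUnion.2 ⟨0, a, ha, rfl⟩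
  have hstable : ∀ a ∈ ⋃ n : ℕ, σ^[n] '' S, σ a ∈ ⋃ n : ℕ, σ^[n] '' S := by
    intro a ha
    obtain ⟨n, b, hb, rfl⟩ := Set.mem_iUnion.1 ha
    exact Set.mem_iUnion.2 ⟨n + 1, b, hb, Function.iterate_succ_apply' _ _ _⟩
  refine isConnectedSet_of_eqvGen ⟨x, hsub hx⟩ ?_
  rintro ⟨a, ha⟩
  obtain ⟨n, b, hb, rfl⟩ := Set.mem_iUnion.1 ha
  induction n with
  | zero => exact hS.eqvGen_of_subset hsub hx hb
  | succ n ih =>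
    have hn : σ^[n] b ∈ ⋃ n : ℕ, σ^[n] '' S := Set.mem_iUnion.2 ⟨n, b, hb, rfl⟩
    have h := eqvGen_map (s := Adj)
      (fun y : FullSubquiver (⋃ n : ℕ, σ^[n] '' S) =>
        (⟨σ y.val, hstable _ y.property⟩ : FullSubquiver (⋃ n : ℕ, σ^[n] '' S)))
      (fun y z hyz => hσ y.val z.val hyz) (ih hn)
    simp only [Function.iterate_succ_apply']
    exact .trans _ _ _ (hS.eqvGen_of_subset hsub hx hσx) h

end GaloisCovering

/-! ### Elements of prime order and the conclusion -/

theorem eq_one_of_pow_prime_eq_one {k : Type w} [Field k]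
    {A : Type u₁} [Category.{v₁} A] [Preadditive A] [Linear k A] {Q : Type u} [Quiver.{v} Q]
    {I : PathIdeal k Q} {Q' : Type u'} [Quiver.{v'} Q'] {ν : Presentation k Q' A}
    (h : ν.IsStronglySimplyConnected) {G : Type u₂} [Group G] {ρ : QuiverAction G Q'}
    {F : Q' ⥤q Q} (hF : IsGaloisCovering ρ F ν.ideal I) {x : Q} {γ : FundamentalGroup I x} {p : ℕ}
    (hp : p.Prime) (hγ : γ ^ p = 1) : γ = 1 := by
  obtain ⟨u, rfl⟩ := Quotient.exists_rep γ
  obtain ⟨x', hx'⟩ := hF.surjective_obj x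
  obtain ⟨y', hy'⟩ := exists_liftsTo hF.isCovering u (x' := x') hx'
  obtain ⟨g, rfl⟩ := hF.orbit_obj x' y' (by
    obtain ⟨-, -, hy, -⟩ := hy'
    exact hx'.trans hy.symm)
  have hgp : g ^ p = 1 := by
    have h₁ : Homotopic I (u.npow p) Path.nil :=
      Quotient.exact (s := homotopySetoid I x) ((FundamentalGroup.mk_npow x u p).trans hγ)
    have h₂ : LiftsTo F (Path.nil : Walk (Symmetrify.of.obj x) (Symmetrify.of.obj x)) x' x' :=
      ⟨Path.nil, hx', hx', Path.cast_nil _⟩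
    exact hF.free _ x' (((hF.liftsTo_iff h₁ _ _).1 (hF.liftsTo_npow hy' p)).right_unique
      hF.isCovering h₂)
  by_cases hg : g = 1
  · subst hg
    rw [ρ.one_obj] at hy'
    obtain ⟨w, hx, -, rfl⟩ := hy'
    change F.obj x' = x at hx
    subst hx
    exact Quotient.sound (s := homotopySetoid I _) ((h.homotopic_nil w).map
      (reflectsIdeal_of_injective_coverOut hF.mapsIdeal hF.isCovering
        fun x' y => (hF.bijective_coverOut x' y).1))
  · exfalso
    let σ : Q' → Q' := (ρ.act g).obj
    have hσ : ∀ a b, Adj a b → Adj (σ a) (σ b) := fun a b ⟨e⟩ => ⟨(ρ.act g).map e⟩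
    have hσp : ∀ a, σ^[p] a = a := fun a => by
      rw [ρ.iterate_obj, hgp, ρ.one_obj]
    have hfree : ∀ a, σ a ≠ a := fun a ha => hg (hF.free g a ha)
    obtain ⟨w, -⟩ := hy'
    obtain ⟨S, hfin, hxS, hyS, hconn, -⟩ := exists_support_walk w
    let C : Set Q' := ⋃ n : ℕ, σ^[n] '' S
    have hC : C.Finite := by
      -- Since `σ` has period `p`, the translates with `n < p` already exhaust `C`.
      have hfin' : (⋃ n ∈ Set.Iio p, σ^[n] '' S).Finite :=
        (Set.finite_Iio p).biUnion fun n _ => hfin.image _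
      refine hfin'.subset ?_
      rintro a ha
      obtain ⟨n, b, hb, rfl⟩ := Set.mem_iUnion.1 ha
      refine Set.mem_biUnion (Nat.mod_lt n hp.pos) ⟨b, hb, ?_⟩
      exact Function.IsPeriodicPt.iterate_mod_apply (hσp b) n
    refine h.not_isConnectedSet hp hσ hσp hfree (finite_hull h.finite_path hC)
      ⟨x', subset_hull _ (Set.mem_iUnion.2 ⟨0, x', hxS, rfl⟩)⟩ (isConvexSet_hull C) ?_
      (hconn.iUnion_image hσ hxS hyS).hull
    have hCσ : ∀ a ∈ C, σ a ∈ C := by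
      intro a ha
      obtain ⟨n, b, hb, rfl⟩ := Set.mem_iUnion.1 ha
      exact Set.mem_iUnion.2 ⟨n + 1, b, hb, Function.iterate_succ_apply' _ _ _⟩
    rintro b ⟨a, ha, c, hc, ⟨q⟩, ⟨r⟩⟩
    exact ⟨σ a, hCσ a ha, σ c, hCσ c hc, ⟨(ρ.act g).mapPath q⟩, ⟨(ρ.act g).mapPath r⟩⟩

end BoundQuiver

theorem mainTheorem2
    {k : Type w} [Field k] [IsAlgClosed k]
    -- the triangular algebra `A`, as a `k`-category, with the given presentation `kQ/I`
    {A : Type u₁} [Category.{v₁} A] [Preadditive A] [Linear k A]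
    {Q : Type u} [Quiver.{v} Q] [Finite Q] (ν : BoundQuiver.Presentation k Q A)
    (hA : BoundQuiver.IsTriangular Q)
    -- the strongly simply connected `k`-category `A'` with a presentation `kQ'/I'`
    {A' : Type u₂} [Category.{v₂} A'] [Preadditive A'] [Linear k A']
    {Q' : Type u'} [Quiver.{v'} Q'] (ν' : BoundQuiver.Presentation k Q' A')
    (hA' : ν'.IsStronglySimplyConnected)
    -- the Galois covering `kQ'/I' → kQ/I`
    {G : Type u₃} [Group G] (ρ : BoundQuiver.QuiverAction G Q') (F : Q' ⥤q Q)
    (hF : BoundQuiver.IsGaloisCovering ρ F ν'.ideal ν.ideal) (x : Q) :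
    ∀ g : BoundQuiver.FundamentalGroup ν.ideal x, IsOfFinOrder g → g = 1 := by
  intro g hg
  by_contra hne
  -- If `g` has order `p * m`, then the `p`-th power of `g ^ m` is trivial, so `g ^ m = 1`, against
  -- the order being larger than `m`.
  obtain ⟨p, hp, hpn⟩ := Nat.exists_prime_and_dvd (mt orderOf_eq_one_iff.1 hne)
  obtain ⟨m, hm⟩ := hpn
  have hm0 : m ≠ 0 := fun h => hg.orderOf_pos.ne' (by rw [hm, h, mul_zero])
  have h1 : g ^ m = 1 := BoundQuiver.eq_one_of_pow_prime_eq_one hA' hF hp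
    (by rw [← pow_mul, mul_comm, ← hm, pow_orderOf_eq_one])
  have hle := Nat.le_of_dvd (Nat.pos_of_ne_zero hm0) (orderOf_dvd_of_pow_eq_one h1)
  rw [hm] at hle
  have := Nat.mul_le_mul_right m hp.two_le
  omega
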